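/- Let $a,b_0,c_0>0$ and $0<\alpha_1<\alpha_2<\alpha_3<\alpha_4<L$, and let $b=b_0\mathbf 1_{(\alpha_1,\alpha_3)}$, $c=c_0\mathbf 1_{(\alpha_2,\alpha_4)}$ on $(0,L)$. All functions are complex valued. Let $\mathcal H=(H^1_0(0,L)\times L^2(0,L))^2$ be the Hilbert space with the inner product $$\langle (u,v,y,z),(u_1,v_1,y_1,z_1)\rangle_{\mathcal H}=\int_0^L v\overline{v_1}\,dx+a\int_0^L u_x\overline{(u_1)_x}\,dx+\int_0^L z\overline{z_1}\,dx+\int_0^L y_x\overline{(y_1)_x}\,dx ,$$ and let $\mathcal A:D(\mathcal A)\subset\mathcal H\to\mathcal H$ be the operator $$\mathcal A(u,v,y,z)=\bigl(v,\ (au_x+b\,v_x)_x-c\,z,\ z,\ y_{xx}+c\,v\bigr),$$ $$D(\mathcal A)=\{(u,v,y,z)\in\mathcal H:\ y\in H^2(0,L)\cap H^1_0(0,L),\ v,z\in H^1_0(0,L),\ (au_x+b\,v_x)_x\in L^2(0,L)\},$$ with derivatives in the weak sense. This is the first order form $U_t=\mathcal AU$, $U(0)=U_0$, with $U=(u,u_t,y,y_t)$,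 of the system $u_{tt}-(au_x+b\,u_{tx})_x+c\,y_t=0$, $y_{tt}-y_{xx}-c\,u_t=0$ on $(0,L)\times\mathbb R^+$ with Dirichlet boundary conditions. Then the following hold. 1. $\mathcal A$ is m-dissipative on $\mathcal H$: $\Re\langle\mathcal AU,U\rangle_{\mathcal H}\le 0$ for all $U\in D(\mathcal A)$, and $rI-\mathcal A:D(\mathcal A)\to\mathcal H$ is onto for every $r>0$. 2. $\mathcal A$ is the infinitesimal generator of a $C_0$-semigroup of contractions $(e^{t\mathcal A})_{t\ge0}$ on $\mathcal H$. 3. For every $U_0\in\mathcal H$ the problem $U_t=\mathcal AU$, $U(0)=U_0$ has exactly one weak solution $U\in C^0(\mathbb R^+,\mathcal H)$, namely $U(t)=e^{t\mathcal A}U_0$. Here a weak solution is a $U\in C^0(\mathbb R^+,\mathcal H)$ with $U(0)=U_0$ such that, for every $V\in D(\mathcal A^*)$, $t\mapsto\langle U(t),V\rangle_{\mathcal H}$ is differentiable on $\mathbb R^+=[0,\infty)$ with derivative $\langle U(t),\mathcal A^*V\rangle_{\mathcal H}$. 4. If $U_0\in D(\mathcal A)$, the problem has exactly one strong solution, that is,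 exactly one $U\in C^1(\mathbb R^+,\mathcal H)\cap C^0(\mathbb R^+,D(\mathcal A))$ with $U(0)=U_0$ and $U'(t)=\mathcal AU(t)$ for all $t\ge0$, where $D(\mathcal A)$ carries the graph norm; again $U(t)=e^{t\mathcal A}U_0$. -/

import Mathlib

open MeasureTheory Set Filter Topology
open scoped ContDiff InnerProductSpace

noncomputable section

/-! ### Abstract evolution equations `U' = A U` in a complex Hilbert space -/

section Abstract

variable {E : Type*} [NormedAddCommGroup E] [InnerProductSpace ℂ E]

/-- `Re ⟨A U, U⟩ ≤ 0` for all `U ∈ D(A)`. -/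
def IsDissipative (A : E →ₗ.[ℂ] E) : Prop :=
  ∀ U : A.domain, (⟪A U, (U : E)⟫_ℂ).re ≤ 0

/-- `A` is dissipative and `r I - A : D(A) → E` is onto for every `r > 0`. -/
def IsMDissipative (A : E →ₗ.[ℂ] E) : Prop :=
  IsDissipative A ∧ ∀ r : ℝ, 0 < r → ∀ F : E, ∃ U : A.domain, (r : ℂ) • (U : E) - A U = F

/-- `(S t)_{t ≥ 0}` is a strongly continuous semigroup of contractions (only the values of `S`
at nonnegative times matter). -/
structure IsC0ContractionSemigroup (S : ℝ → E →L[ℂ] E) : Prop where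
  zero : S 0 = ContinuousLinearMap.id ℂ E
  add : ∀ s t : ℝ, 0 ≤ s → 0 ≤ t → S (s + t) = (S s).comp (S t)
  contraction : ∀ t : ℝ, 0 ≤ t → ‖S t‖ ≤ 1
  strong : ∀ U : E, ContinuousOn (fun t => S t U) (Ici 0)

/-- `A` is the infinitesimal generator of `(S t)_{t ≥ 0}`: `U ∈ D(A)` with `A U = W` if and only if
`(S t U - U) / t → W` as `t → 0⁺`. -/
def IsGenerator (S : ℝ → E →L[ℂ] E) (A : E →ₗ.[ℂ] E) : Prop :=
  ∀ U W : E, (U, W) ∈ A.graph ↔ Tendsto (fun t : ℝ => t⁻¹ • (S t U - U)) (𝓝[>] 0) (𝓝 W)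

/-- Weak solution on `[0, ∞)` of `U' = A U`, `U(0) = U₀`: a continuous `U` such that, for all `V` in
the domain of the adjoint of `A`, with `W = A* V`, the function `⟨V, U(t)⟩` has the derivative
`⟨W, U(t)⟩` at every `t ≥ 0` (one-sided at `0`). Here `V ∈ D(A*)`, `W = A* V` is spelled out as
`⟨V, A X⟩ = ⟨W, X⟩` for all `X ∈ D(A)`. -/
structure IsWeakSolution (A : E →ₗ.[ℂ] E) (U₀ : E) (U : ℝ → E) : Prop where
  init : U 0 = U₀
  cont : ContinuousOn U (Ici 0)
  eqn : ∀ V W : E, (∀ X : A.domain, ⟪V, A X⟫_ℂ = ⟪W, (X : E)⟫_ℂ) →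
    ∀ t : ℝ, 0 ≤ t → HasDerivWithinAt (fun s => ⟪V, U s⟫_ℂ) ⟪W, U t⟫_ℂ (Ici 0) t

/-- Strong solution on `[0, ∞)` of `U' = A U`, `U(0) = U₀`: `U` is of class `C¹` with values in `E`
and `C⁰` with values in `D(A)` with the graph norm (that is, `U` and `AU = A ∘ U` are continuous),
and `U'(t) = A U(t)` for all `t ≥ 0` (one-sided at `0`). -/
structure IsStrongSolution (A : E →ₗ.[ℂ] E) (U₀ : E) (U : ℝ → E) : Prop where
  init : U 0 = U₀
  contDiff : ContDiffOn ℝ 1 U (Ici 0)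
  eqn : ∃ AU : ℝ → E, (∀ t : ℝ, 0 ≤ t → (U t, AU t) ∈ A.graph) ∧ ContinuousOn AU (Ici 0) ∧
    ∀ t : ℝ, 0 ≤ t → HasDerivWithinAt U (AU t) (Ici 0) t

end Abstract

/-! ### Sobolev spaces on `(0, L)` -/

/-- Lebesgue measure on `(0, L)`. -/
abbrev muI (L : ℝ) : Measure ℝ := volume.restrict (Ioo 0 L)

/-- `L²(0, L)`, complex valued. -/
abbrev L2 (L : ℝ) : Type := Lp ℂ 2 (muI L)

/-- `φ ∈ C_c^∞(0, L)`. -/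
structure IsTestFun (L : ℝ) (φ : ℝ → ℂ) : Prop where
  smooth : ContDiff ℝ ∞ φ
  compact : HasCompactSupport φ
  supp : tsupport φ ⊆ Ioo 0 L

/-- `g` is the weak derivative of `f` on `(0, L)`. -/
def HasWeakDeriv (L : ℝ) (f g : L2 L) : Prop :=
  ∀ φ : ℝ → ℂ, IsTestFun L φ →
    ∫ x in Ioo 0 L, f x * deriv φ x = - ∫ x in Ioo 0 L, g x * φ x

namespace IsTestFun

variable {L : ℝ} {φ ψ : ℝ → ℂ}

theorem zero : IsTestFun L (fun _ => 0) where
  smooth := contDiff_const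
  compact := HasCompactSupport.zero
  supp := by
    have : tsupport (fun _ : ℝ => (0 : ℂ)) = ∅ := tsupport_eq_empty_iff.2 rfl
    simp [this]

theorem add (hφ : IsTestFun L φ) (hψ : IsTestFun L ψ) : IsTestFun L (φ + ψ) where
  smooth := hφ.smooth.add hψ.smooth
  compact := hφ.compact.add hψ.compact
  supp := (tsupport_add φ ψ).trans (union_subset hφ.supp hψ.supp)

theorem const_smul (c : ℂ) (hφ : IsTestFun L φ) : IsTestFun L (c • φ) where
  smooth := contDiff_const.smul hφ.smooth
  compact := hφ.compact.smul_left (f := fun _ => c)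
  supp := (tsupport_smul_subset_right (fun _ => c) φ).trans hφ.supp

theorem differentiable (hφ : IsTestFun L φ) : Differentiable ℝ φ :=
  hφ.smooth.differentiable (by simp)

theorem deriv_test (hφ : IsTestFun L φ) : IsTestFun L (deriv φ) where
  smooth := (contDiff_infty_iff_deriv.1 hφ.smooth).2
  compact := hφ.compact.deriv
  supp := (tsupport_deriv_subset (f := φ)).trans hφ.supp

theorem memLp (hφ : IsTestFun L φ) (p : ENNReal) : MemLp φ p (muI L) :=
  (hφ.smooth.continuous.memLp_of_hasCompactSupport hφ.compact).restrict _

theorem integrable_mul (hφ : IsTestFun L φ) (f : L2 L) :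
    Integrable (fun x => f x * φ x) (muI L) :=
  MemLp.integrable_mul (Lp.memLp f) (hφ.memLp 2)

end IsTestFun

theorem HasWeakDeriv.add {L : ℝ} {f₁ f₂ g₁ g₂ : L2 L} (h₁ : HasWeakDeriv L f₁ g₁)
    (h₂ : HasWeakDeriv L f₂ g₂) : HasWeakDeriv L (f₁ + f₂) (g₁ + g₂) := by
  intro φ hφ
  have e1 : ∫ x in Ioo 0 L, (f₁ + f₂ : L2 L) x * deriv φ x =
      ∫ x in Ioo 0 L, (f₁ x * deriv φ x + f₂ x * deriv φ x) := by
    refine integral_congr_ae ?_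
    filter_upwards [Lp.coeFn_add f₁ f₂] with x hx
    rw [hx, Pi.add_apply, add_mul]
  have e2 : ∫ x in Ioo 0 L, (g₁ + g₂ : L2 L) x * φ x =
      ∫ x in Ioo 0 L, (g₁ x * φ x + g₂ x * φ x) := by
    refine integral_congr_ae ?_
    filter_upwards [Lp.coeFn_add g₁ g₂] with x hx
    rw [hx, Pi.add_apply, add_mul]
  rw [e1, e2, integral_add (hφ.deriv_test.integrable_mul _) (hφ.deriv_test.integrable_mul _),
    integral_add (hφ.integrable_mul _) (hφ.integrable_mul _), h₁ φ hφ, h₂ φ hφ]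
  ring

theorem HasWeakDeriv.smul {L : ℝ} {f g : L2 L} (c : ℂ) (h : HasWeakDeriv L f g) :
    HasWeakDeriv L (c • f) (c • g) := by
  intro φ hφ
  have e1 : ∫ x in Ioo 0 L, (c • f : L2 L) x * deriv φ x =
      ∫ x in Ioo 0 L, c * (f x * deriv φ x) := by
    refine integral_congr_ae ?_
    filter_upwards [Lp.coeFn_smul c f] with x hx
    rw [hx, Pi.smul_apply, smul_eq_mul, mul_assoc]
  have e2 : ∫ x in Ioo 0 L, (c • g : L2 L) x * φ x =
      ∫ x in Ioo 0 L, c * (g x * φ x) := by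
    refine integral_congr_ae ?_
    filter_upwards [Lp.coeFn_smul c g] with x hx
    rw [hx, Pi.smul_apply, smul_eq_mul, mul_assoc]
  rw [e1, e2, integral_const_mul, integral_const_mul, h φ hφ]
  ring

theorem HasWeakDeriv.zero (L : ℝ) : HasWeakDeriv L 0 0 := by
  intro φ hφ
  have e (ψ : ℝ → ℂ) : ∫ x in Ioo 0 L, (0 : L2 L) x * ψ x = 0 := by
    refine integral_eq_zero_of_ae ?_
    filter_upwards [Lp.coeFn_zero ℂ 2 (muI L)] with x hx
    rw [hx]; simp
  rw [e, e, neg_zero]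

/-- Weak derivatives are unique. -/
theorem HasWeakDeriv.unique {L : ℝ} {f g₁ g₂ : L2 L} (h₁ : HasWeakDeriv L f g₁)
    (h₂ : HasWeakDeriv L f g₂) : g₁ = g₂ := by
  have key : ∀ᵐ x ∂(volume : Measure ℝ), x ∈ Ioo 0 L → (g₁ x - g₂ x) = 0 := by
    refine isOpen_Ioo.ae_eq_zero_of_integral_contDiff_smul_eq_zero
      (f := fun x => g₁ x - g₂ x) ?_ ?_
    · have : IntegrableOn (fun x => g₁ x - g₂ x) (Ioo 0 L) volume :=
        ((Lp.memLp g₁).integrable (by norm_num)).sub ((Lp.memLp g₂).integrable (by norm_num))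
      exact this.locallyIntegrableOn
    · intro g hg hgc hgs
      have hφ : IsTestFun L (fun x => (g x : ℂ)) := by
        have hsub : tsupport (fun x => (g x : ℂ)) ⊆ tsupport g := by
          refine closure_mono fun x hx => ?_
          simpa using hx
        exact ⟨Complex.ofRealCLM.contDiff.comp hg, hgc.mono' (by
          refine fun x hx => subset_tsupport _ ?_
          simpa using hx), hsub.trans hgs⟩
      have e := (h₁ _ hφ).symm.trans (h₂ _ hφ)
      rw [neg_inj] at e
      have e3 : ∫ x in Ioo 0 L, (g₁ x * (g x : ℂ) - g₂ x * (g x : ℂ)) = 0 := by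
        rw [integral_sub (hφ.integrable_mul _) (hφ.integrable_mul _), e, sub_self]
      rw [← setIntegral_eq_integral_of_forall_compl_eq_zero (s := Ioo 0 L), ← e3]
      · refine integral_congr_ae (Eventually.of_forall fun x => ?_)
        simp only [Complex.real_smul]
        ring
      · intro x hx
        have : g x = 0 := by
          by_contra hne
          exact hx (hgs (subset_tsupport _ hne))
        simp [this]
  refine Lp.ext ?_
  rw [Filter.EventuallyEq, ae_restrict_iff' measurableSet_Ioo]
  filter_upwards [key] with x hx hxm using sub_eq_zero.1 (hx hxm)

/-- `H¹(0, L)`, as a subspace of `L²(0, L)`. -/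
def H1 (L : ℝ) : Submodule ℂ (L2 L) where
  carrier := {f | ∃ g, HasWeakDeriv L f g}
  zero_mem' := ⟨0, HasWeakDeriv.zero L⟩
  add_mem' := by
    rintro f₁ f₂ ⟨g₁, h₁⟩ ⟨g₂, h₂⟩
    exact ⟨_, h₁.add h₂⟩
  smul_mem' := by
    rintro c f ⟨g, h⟩
    exact ⟨_, h.smul c⟩

open Classical in
/-- The weak derivative `f_x` of `f ∈ H¹(0, L)` (and `0` for other `f`). -/
def weakDeriv (L : ℝ) (f : L2 L) : L2 L :=
  if h : ∃ g, HasWeakDeriv L f g then h.choose else 0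

theorem hasWeakDeriv_weakDeriv {L : ℝ} {f : L2 L} (hf : f ∈ H1 L) :
    HasWeakDeriv L f (weakDeriv L f) := by
  have h : ∃ g, HasWeakDeriv L f g := hf
  rw [weakDeriv, dif_pos h]
  exact h.choose_spec

theorem HasWeakDeriv.weakDeriv_eq {L : ℝ} {f g : L2 L} (h : HasWeakDeriv L f g) :
    weakDeriv L f = g :=
  (hasWeakDeriv_weakDeriv (L := L) ⟨g, h⟩).unique h

theorem weakDeriv_add {L : ℝ} {f g : L2 L} (hf : f ∈ H1 L) (hg : g ∈ H1 L) :
    weakDeriv L (f + g) = weakDeriv L f + weakDeriv L g :=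
  ((hasWeakDeriv_weakDeriv hf).add (hasWeakDeriv_weakDeriv hg)).weakDeriv_eq

theorem weakDeriv_smul {L : ℝ} {f : L2 L} (c : ℂ) (hf : f ∈ H1 L) :
    weakDeriv L (c • f) = c • weakDeriv L f :=
  ((hasWeakDeriv_weakDeriv hf).smul c).weakDeriv_eq

/-- `H²(0, L)`: the functions `f ∈ H¹(0, L)` with `f_x ∈ H¹(0, L)`. -/
def H2 (L : ℝ) : Submodule ℂ (L2 L) where
  carrier := {f | f ∈ H1 L ∧ weakDeriv L f ∈ H1 L}
  zero_mem' := ⟨zero_mem _, by rw [(HasWeakDeriv.zero L).weakDeriv_eq]; exact zero_mem _⟩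
  add_mem' := by
    rintro f g ⟨hf, hf'⟩ ⟨hg, hg'⟩
    exact ⟨add_mem hf hg, by rw [weakDeriv_add hf hg]; exact add_mem hf' hg'⟩
  smul_mem' := by
    rintro c f ⟨hf, hf'⟩
    exact ⟨Submodule.smul_mem _ c hf, by
      rw [weakDeriv_smul c hf]; exact Submodule.smul_mem _ c hf'⟩

/-- The pairs `(φ, φ')` with `φ ∈ C_c^∞(0, L)`, in `L²(0, L) × L²(0, L)`. -/
def testGraph (L : ℝ) : Submodule ℂ (L2 L × L2 L) where
  carrier := {p | ∃ φ : ℝ → ℂ, IsTestFun L φ ∧ p.1 =ᵐ[muI L] φ ∧ p.2 =ᵐ[muI L] deriv φ}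
  zero_mem' := ⟨fun _ => 0, IsTestFun.zero, Lp.coeFn_zero _ _ _, by
    have : deriv (fun _ : ℝ => (0 : ℂ)) = 0 := by ext; simp
    rw [this]; exact Lp.coeFn_zero _ _ _⟩
  add_mem' := by
    rintro p q ⟨φ, hφ, h1, h2⟩ ⟨ψ, hψ, k1, k2⟩
    refine ⟨φ + ψ, hφ.add hψ, (Lp.coeFn_add _ _).trans (h1.add k1), ?_⟩
    have : deriv (φ + ψ) = deriv φ + deriv ψ := by
      ext x; exact deriv_add (hφ.differentiable x) (hψ.differentiable x)
    rw [this]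
    exact (Lp.coeFn_add _ _).trans (h2.add k2)
  smul_mem' := by
    rintro c p ⟨φ, hφ, h1, h2⟩
    refine ⟨c • φ, hφ.const_smul c, (Lp.coeFn_smul _ _).trans (h1.const_smul c), ?_⟩
    have : deriv (c • φ) = c • deriv φ := by
      ext x; exact deriv_const_smul c (hφ.differentiable x)
    rw [this]
    exact (Lp.coeFn_smul _ _).trans (h2.const_smul c)

/-- `H¹₀(0, L)`: the closure of `C_c^∞(0, L)` in `H¹(0, L)`, that is, the `u` for which there is
`w` such that `(u, w)` is a limit in `L² × L²` of pairs `(φ, φ')` with `φ ∈ C_c^∞(0, L)`; then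
`w = u_x` (see `hasWeakDeriv_of_mem_closure`). -/
def H10 (L : ℝ) : Submodule ℂ (L2 L) :=
  (testGraph L).topologicalClosure.map (LinearMap.fst ℂ (L2 L) (L2 L))

/-- `f ↦ ∫ f φ` is continuous on `L²(0, L)`. -/
theorem continuous_integral_mul_test {L : ℝ} {φ : ℝ → ℂ} (hφ : IsTestFun L φ) :
    Continuous (fun f : L2 L => ∫ x in Ioo 0 L, f x * φ x) := by
  have hm : MemLp (fun x => (starRingEnd ℂ) (φ x)) 2 (muI L) := (hφ.memLp 2).star
  have : (fun f : L2 L => ∫ x in Ioo 0 L, f x * φ x) = fun f : L2 L => ⟪hm.toLp _, f⟫_ℂ := by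
    ext f
    rw [L2.inner_def]
    refine integral_congr_ae ?_
    filter_upwards [hm.coeFn_toLp] with x hx
    rw [hx]
    simp
  rw [this]
  fun_prop

theorem hasWeakDeriv_of_mem_closure {L : ℝ} {p : L2 L × L2 L}
    (hp : p ∈ (testGraph L).topologicalClosure) : HasWeakDeriv L p.1 p.2 := by
  intro φ hφ
  have hcl : IsClosed {q : L2 L × L2 L |
      ∫ x in Ioo 0 L, q.1 x * deriv φ x = - ∫ x in Ioo 0 L, q.2 x * φ x} :=
    isClosed_eq ((continuous_integral_mul_test hφ.deriv_test).comp continuous_fst)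
      ((continuous_integral_mul_test hφ).comp continuous_snd).neg
  refine closure_minimal ?_ hcl hp
  rintro q ⟨ψ, hψ, h1, h2⟩
  have e1 : ∫ x in Ioo 0 L, q.1 x * deriv φ x = ∫ x, ψ x * deriv φ x := by
    refine Eq.trans (b := ∫ x in Ioo 0 L, ψ x * deriv φ x) (integral_congr_ae ?_)
      (setIntegral_eq_integral_of_forall_compl_eq_zero fun x hx => ?_)
    · filter_upwards [h1] with x hx
      rw [hx]
    · rw [image_eq_zero_of_notMem_tsupport (fun h => hx (hψ.supp h)), zero_mul]
  have e2 : ∫ x in Ioo 0 L, q.2 x * φ x = ∫ x, deriv ψ x * φ x := by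
    refine Eq.trans (b := ∫ x in Ioo 0 L, deriv ψ x * φ x) (integral_congr_ae ?_)
      (setIntegral_eq_integral_of_forall_compl_eq_zero fun x hx => ?_)
    · filter_upwards [h2] with x hx
      rw [hx]
    · rw [image_eq_zero_of_notMem_tsupport (fun h => hx (hφ.supp h)), mul_zero]
  change ∫ x in Ioo 0 L, q.1 x * deriv φ x = - ∫ x in Ioo 0 L, q.2 x * φ x
  rw [e1, e2]
  have hint {f g : ℝ → ℂ} (hf : IsTestFun L f) (hg : IsTestFun L g) :
      Integrable (f * g) volume :=
    (hf.smooth.continuous.mul hg.smooth.continuous).integrable_of_hasCompactSupport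
      hf.compact.mul_right
  exact integral_mul_deriv_eq_deriv_mul_of_integrable
    (fun x _ => (hψ.differentiable x).hasDerivAt) (fun x _ => (hφ.differentiable x).hasDerivAt)
    (hint hψ hφ.deriv_test) (hint hψ.deriv_test hφ) (hint hψ hφ)

theorem mem_closure_of_mem_H10 {L : ℝ} {u : L2 L} (hu : u ∈ H10 L) :
    (u, weakDeriv L u) ∈ (testGraph L).topologicalClosure := by
  obtain ⟨p, hp, rfl⟩ := hu
  have : weakDeriv L p.1 = p.2 := (hasWeakDeriv_of_mem_closure hp).weakDeriv_eq
  have e : ((p.1, weakDeriv L p.1) : L2 L × L2 L) = p := Prod.ext rfl this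
  change (p.1, weakDeriv L p.1) ∈ (testGraph L).topologicalClosure
  rwa [e]

theorem H10_le_H1 (L : ℝ) : H10 L ≤ H1 L := by
  rintro u ⟨p, hp, rfl⟩
  exact ⟨p.2, hasWeakDeriv_of_mem_closure hp⟩

theorem norm_le_of_mem_testGraph {L : ℝ} {f g : L2 L} (h : (f, g) ∈ testGraph L) :
    ‖f‖ ≤ (measureUnivNNReal (muI L) : ℝ) ^ (ENNReal.toReal 2)⁻¹ *
      (‖(memLp_const 1 : MemLp (fun _ : ℝ => (1 : ℝ)) 2 (muI L)).toLp _‖ * ‖g‖) := by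
  have h1 : MemLp (fun _ : ℝ => (1 : ℝ)) 2 (muI L) := memLp_const 1
  obtain ⟨φ, hφ, hf, hg⟩ := h
  have hgn : MemLp (fun x => ‖g x‖) 2 (muI L) := (Lp.memLp g).norm
  have hL1 : ∫ x in Ioo 0 L, ‖deriv φ x‖ ≤ ‖h1.toLp _‖ * ‖g‖ := by
    have e : ∫ x in Ioo 0 L, ‖deriv φ x‖ = ⟪h1.toLp _, hgn.toLp _⟫_ℝ := by
      rw [L2.inner_def]
      refine integral_congr_ae ?_
      filter_upwards [hg, h1.coeFn_toLp, hgn.coeFn_toLp] with x hx k1 k2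
      change g x = _ at hx
      rw [k1, k2, ← hx]
      simp
    have e' : ‖hgn.toLp _‖ = ‖g‖ := by
      rw [Lp.norm_toLp, eLpNorm_norm, Lp.norm_def]
    rw [e, ← e']
    exact real_inner_le_norm _ _
  have hsup : ∀ x ∈ Ioo 0 L, ‖φ x‖ ≤ ∫ x in Ioo 0 L, ‖deriv φ x‖ := by
    intro x hx
    have h0 : φ 0 = 0 := image_eq_zero_of_notMem_tsupport (fun h => by
      have := (hφ.supp h).1
      exact lt_irrefl _ this)
    have hF : ∫ s in (0 : ℝ)..x, deriv φ s = φ x - φ 0 :=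
      intervalIntegral.integral_deriv_eq_sub (fun s _ => hφ.differentiable s)
        (hφ.deriv_test.smooth.continuous.intervalIntegrable _ _)
    rw [h0, sub_zero] at hF
    rw [← hF]
    refine (intervalIntegral.norm_integral_le_integral_norm hx.1.le).trans ?_
    rw [intervalIntegral.integral_of_le hx.1.le]
    refine setIntegral_mono_set ((hφ.deriv_test.memLp 1).integrable le_rfl).norm
      (Eventually.of_forall fun _ => norm_nonneg _) (LE.le.eventuallyLE ?_)
    exact fun s hs => ⟨hs.1, hs.2.trans_lt hx.2⟩
  have hbd : ∀ᵐ x ∂(muI L), ‖f x‖ ≤ ‖h1.toLp _‖ * ‖g‖ := by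
    filter_upwards [hf, ae_restrict_mem measurableSet_Ioo] with x hx hxm
    change f x = _ at hx
    rw [hx]
    exact (hsup x hxm).trans hL1
  exact Lp.norm_le_of_ae_bound (p := 2) (mul_nonneg (norm_nonneg _) (norm_nonneg g)) hbd

/-- Poincaré's inequality. -/
theorem poincare (L : ℝ) : ∃ C : ℝ, ∀ u ∈ H10 L, ‖u‖ ≤ C * ‖weakDeriv L u‖ := by
  have h1 : MemLp (fun _ : ℝ => (1 : ℝ)) 2 (muI L) := memLp_const 1
  obtain ⟨C, hC⟩ : ∃ C : ℝ, C = (measureUnivNNReal (muI L) : ℝ) ^ (ENNReal.toReal 2)⁻¹ *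
    ‖h1.toLp _‖ := ⟨_, rfl⟩
  refine ⟨C, fun u hu => ?_⟩
  have hcl : IsClosed {q : L2 L × L2 L | ‖q.1‖ ≤ C * ‖q.2‖} :=
    isClosed_le continuous_fst.norm (continuous_const.mul continuous_snd.norm)
  have hsub : (testGraph L : Set (L2 L × L2 L)) ⊆ {q : L2 L × L2 L | ‖q.1‖ ≤ C * ‖q.2‖} := by
    rintro ⟨f, g⟩ hq
    have := norm_le_of_mem_testGraph hq
    rw [← mul_assoc, ← hC] at this
    exact this
  have hmem := closure_minimal hsub hcl (mem_closure_of_mem_H10 hu)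
  exact hmem

/-! ### The coupled system -/

/-- The constants of the system, with `0 < α₁ < α₂ < α₃ < α₄ < L` and `a, b₀, c₀ > 0`. -/
structure WaveData where
  (a b₀ c₀ α₁ α₂ α₃ α₄ L : ℝ)
  a_pos : 0 < a
  b₀_pos : 0 < b₀
  c₀_pos : 0 < c₀
  α₁_pos : 0 < α₁
  α₁₂ : α₁ < α₂
  α₂₃ : α₂ < α₃
  α₃₄ : α₃ < α₄
  α₄L : α₄ < L

/-- The function equal to `k` on `(s, t)` and to `0` elsewhere. -/
def stepFun (k s t : ℝ) : ℝ → ℝ := (Ioo s t).indicator fun _ => k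

theorem stepFun_mul_memLp {L : ℝ} (k s t : ℝ) (f : L2 L) :
    MemLp (fun x => (stepFun k s t x : ℂ) * f x) 2 (muI L) := by
  have : (fun x => (stepFun k s t x : ℂ) * f x) = (Ioo s t).indicator (fun x => (k : ℂ) * f x) := by
    ext x
    by_cases hx : x ∈ Ioo s t <;> simp [stepFun, hx]
  rw [this]
  exact ((Lp.memLp f).const_mul _).indicator measurableSet_Ioo

/-- Multiplication by `stepFun k s t` on `L²(0, L)`. -/
def stepMul (L k s t : ℝ) : L2 L →ₗ[ℂ] L2 L where
  toFun f := (stepFun_mul_memLp k s t f).toLp _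
  map_add' f g := by
    refine Lp.ext ?_
    filter_upwards [(stepFun_mul_memLp k s t (f + g)).coeFn_toLp,
      Lp.coeFn_add ((stepFun_mul_memLp k s t f).toLp _) ((stepFun_mul_memLp k s t g).toLp _),
      (stepFun_mul_memLp k s t f).coeFn_toLp, (stepFun_mul_memLp k s t g).coeFn_toLp,
      Lp.coeFn_add f g] with x h1 h2 h3 h4 h5
    rw [h1, h2, Pi.add_apply, h3, h4, h5, Pi.add_apply, mul_add]
  map_smul' c f := by
    refine Lp.ext ?_
    filter_upwards [(stepFun_mul_memLp k s t (c • f)).coeFn_toLp,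
      Lp.coeFn_smul c ((stepFun_mul_memLp k s t f).toLp _),
      (stepFun_mul_memLp k s t f).coeFn_toLp, Lp.coeFn_smul c f] with x h1 h2 h3 h4
    simp only [RingHom.id_apply]
    rw [h1, h2, Pi.smul_apply, h3, h4, Pi.smul_apply, smul_eq_mul, smul_eq_mul]
    ring

namespace WaveData

variable (P : WaveData)

/-- Multiplication by `b(x)`, with `b = b₀` on `(α₁, α₃)` and `b = 0` elsewhere. -/
def mulB : L2 P.L →ₗ[ℂ] L2 P.L := stepMul P.L P.b₀ P.α₁ P.α₃

/-- Multiplication by `c(x)`, with `c = c₀` on `(α₂, α₄)` and `c = 0` elsewhere. -/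
def mulC : L2 P.L →ₗ[ℂ] L2 P.L := stepMul P.L P.c₀ P.α₂ P.α₄

/-- The energy space `(H¹₀(0, L) × L²(0, L))²`, whose elements are written `(u, v, y, z)`. It is
normed by the energy inner product below. -/
def EnergySpace : Type := H10 P.L × L2 P.L × H10 P.L × L2 P.L

namespace EnergySpace

instance : AddCommGroup P.EnergySpace :=
  inferInstanceAs (AddCommGroup (H10 P.L × L2 P.L × H10 P.L × L2 P.L))

instance : Module ℂ P.EnergySpace :=
  inferInstanceAs (Module ℂ (H10 P.L × L2 P.L × H10 P.L × L2 P.L))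

variable {P}

def mk (u : H10 P.L) (v : L2 P.L) (y : H10 P.L) (z : L2 P.L) : P.EnergySpace := (u, v, y, z)

def u (U : P.EnergySpace) : L2 P.L := U.1.1
def v (U : P.EnergySpace) : L2 P.L := U.2.1
def y (U : P.EnergySpace) : L2 P.L := U.2.2.1.1
def z (U : P.EnergySpace) : L2 P.L := U.2.2.2

/-- The derivative `u_x`. -/
def ux (U : P.EnergySpace) : L2 P.L := weakDeriv P.L U.u

/-- The derivative `y_x`. -/
def yx (U : P.EnergySpace) : L2 P.L := weakDeriv P.L U.y

theorem u_mem (U : P.EnergySpace) : U.u ∈ H10 P.L := U.1.2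
theorem y_mem (U : P.EnergySpace) : U.y ∈ H10 P.L := U.2.2.1.2

theorem ext' {U V : P.EnergySpace} (h1 : U.u = V.u) (h2 : U.v = V.v) (h3 : U.y = V.y)
    (h4 : U.z = V.z) : U = V :=
  Prod.ext (Subtype.ext h1) (Prod.ext h2 (Prod.ext (Subtype.ext h3) h4))

theorem u_add (U V : P.EnergySpace) : (U + V).u = U.u + V.u := rfl
theorem v_add (U V : P.EnergySpace) : (U + V).v = U.v + V.v := rfl
theorem y_add (U V : P.EnergySpace) : (U + V).y = U.y + V.y := rfl
theorem z_add (U V : P.EnergySpace) : (U + V).z = U.z + V.z := rfl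
theorem u_smul (c : ℂ) (U : P.EnergySpace) : (c • U).u = c • U.u := rfl
theorem v_smul (c : ℂ) (U : P.EnergySpace) : (c • U).v = c • U.v := rfl
theorem y_smul (c : ℂ) (U : P.EnergySpace) : (c • U).y = c • U.y := rfl
theorem z_smul (c : ℂ) (U : P.EnergySpace) : (c • U).z = c • U.z := rfl

theorem ux_add (U V : P.EnergySpace) : (U + V).ux = U.ux + V.ux :=
  weakDeriv_add (H10_le_H1 _ U.u_mem) (H10_le_H1 _ V.u_mem)
theorem yx_add (U V : P.EnergySpace) : (U + V).yx = U.yx + V.yx :=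
  weakDeriv_add (H10_le_H1 _ U.y_mem) (H10_le_H1 _ V.y_mem)
theorem ux_smul (c : ℂ) (U : P.EnergySpace) : (c • U).ux = c • U.ux :=
  weakDeriv_smul c (H10_le_H1 _ U.u_mem)
theorem yx_smul (c : ℂ) (U : P.EnergySpace) : (c • U).yx = c • U.yx :=
  weakDeriv_smul c (H10_le_H1 _ U.y_mem)

theorem re_self (U : P.EnergySpace) :
    RCLike.re (⟪U.v, U.v⟫_ℂ + (P.a : ℂ) * ⟪U.ux, U.ux⟫_ℂ + ⟪U.z, U.z⟫_ℂ + ⟪U.yx, U.yx⟫_ℂ) =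
      ‖U.v‖ ^ 2 + P.a * ‖U.ux‖ ^ 2 + ‖U.z‖ ^ 2 + ‖U.yx‖ ^ 2 := by
  simp only [map_add, RCLike.re_to_complex, Complex.re_ofReal_mul]
  simp only [← RCLike.re_to_complex, inner_self_eq_norm_sq]

/-- The energy inner product `∫ v v̄₁ + a ∫ u_x (ū₁)_x + ∫ z z̄₁ + ∫ y_x (ȳ₁)_x`, where, as always in
Mathlib, the inner product is conjugate linear in the first argument, so that `core.inner U₁ U` is
this expression. -/
@[reducible]
def core : InnerProductSpace.Core ℂ P.EnergySpace where
  inner U V := ⟪U.v, V.v⟫_ℂ + (P.a : ℂ) * ⟪U.ux, V.ux⟫_ℂ + ⟪U.z, V.z⟫_ℂ + ⟪U.yx, V.yx⟫_ℂ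
  conj_inner_symm U V := by
    simp only [map_add, map_mul, inner_conj_symm, Complex.conj_ofReal]
  re_inner_nonneg U := by
    rw [re_self]
    have := P.a_pos.le
    positivity
  add_left U V W := by
    simp only [v_add, ux_add, z_add, yx_add, inner_add_left]
    ring
  smul_left U V c := by
    simp only [v_smul, ux_smul, z_smul, yx_smul, inner_smul_left]
    ring
  definite U h := by
    have ha := P.a_pos
    replace h := (re_self U).symm.trans ((congrArg _ h).trans (map_zero _))
    have h1 := sq_nonneg ‖U.v‖
    have h2 := mul_nonneg ha.le (sq_nonneg ‖U.ux‖)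
    have h3 := sq_nonneg ‖U.z‖
    have h4 := sq_nonneg ‖U.yx‖
    have k1 : ‖U.v‖ = 0 := by rw [← sq_eq_zero_iff]; linarith
    have k2 : ‖U.ux‖ = 0 := by
      rw [← sq_eq_zero_iff]
      have : P.a * ‖U.ux‖ ^ 2 = 0 := by linarith
      exact (mul_eq_zero.1 this).resolve_left ha.ne'
    have k3 : ‖U.z‖ = 0 := by rw [← sq_eq_zero_iff]; linarith
    have k4 : ‖U.yx‖ = 0 := by rw [← sq_eq_zero_iff]; linarith
    obtain ⟨C, hC⟩ := poincare P.L
    have k5 : ‖U.u‖ ≤ 0 := by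
      have := hC _ U.u_mem
      change ‖U.u‖ ≤ C * ‖U.ux‖ at this
      simpa [k2] using this
    have k6 : ‖U.y‖ ≤ 0 := by
      have := hC _ U.y_mem
      change ‖U.y‖ ≤ C * ‖U.yx‖ at this
      simpa [k4] using this
    exact ext' (norm_le_zero_iff.1 k5) (norm_eq_zero.1 k1) (norm_le_zero_iff.1 k6)
      (norm_eq_zero.1 k3)

instance : NormedAddCommGroup P.EnergySpace := core.toNormedAddCommGroup

instance : InnerProductSpace ℂ P.EnergySpace := InnerProductSpace.ofCore core.toCore

theorem inner_def (U V : P.EnergySpace) :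
    ⟪U, V⟫_ℂ = ⟪U.v, V.v⟫_ℂ + (P.a : ℂ) * ⟪U.ux, V.ux⟫_ℂ + ⟪U.z, V.z⟫_ℂ + ⟪U.yx, V.yx⟫_ℂ := rfl

theorem norm_sq (U : P.EnergySpace) :
    ‖U‖ ^ 2 = ‖U.v‖ ^ 2 + P.a * ‖U.ux‖ ^ 2 + ‖U.z‖ ^ 2 + ‖U.yx‖ ^ 2 := by
  rw [← re_self, ← inner_def, inner_self_eq_norm_sq]

/-- The energy space is a Hilbert space. -/
instance : CompleteSpace P.EnergySpace := by
  have ha := P.a_pos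
  obtain ⟨C, hC⟩ := poincare P.L
  refine Metric.complete_of_cauchySeq_tendsto fun U hU => ?_
  have lim (T : P.EnergySpace →+ L2 P.L) (K : ℝ) (hK : ∀ X, ‖T X‖ ≤ K * ‖X‖) :
      ∃ f, Tendsto (fun n => T (U n)) atTop (𝓝 f) :=
    cauchySeq_tendsto_of_complete (hU.map (uniformContinuous_addMonoidHom_of_continuous
      (AddMonoidHomClass.continuous_of_bound T K hK)))
  have b1 (X : P.EnergySpace) : ‖X.v‖ ≤ 1 * ‖X‖ := by
    rw [one_mul]
    refine abs_le_of_sq_le_sq' ?_ (norm_nonneg _) |>.2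
    have : 0 ≤ P.a * ‖X.ux‖ ^ 2 + ‖X.z‖ ^ 2 + ‖X.yx‖ ^ 2 := by positivity
    linarith [norm_sq X]
  have b2 (X : P.EnergySpace) : ‖X.z‖ ≤ 1 * ‖X‖ := by
    rw [one_mul]
    refine abs_le_of_sq_le_sq' ?_ (norm_nonneg _) |>.2
    have : 0 ≤ ‖X.v‖ ^ 2 + P.a * ‖X.ux‖ ^ 2 + ‖X.yx‖ ^ 2 := by positivity
    linarith [norm_sq X]
  have b3 (X : P.EnergySpace) : ‖X.yx‖ ≤ 1 * ‖X‖ := by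
    rw [one_mul]
    refine abs_le_of_sq_le_sq' ?_ (norm_nonneg _) |>.2
    have : 0 ≤ ‖X.v‖ ^ 2 + P.a * ‖X.ux‖ ^ 2 + ‖X.z‖ ^ 2 := by positivity
    linarith [norm_sq X]
  have b4 (X : P.EnergySpace) : ‖X.ux‖ ≤ (√P.a)⁻¹ * ‖X‖ := by
    have hs : 0 < √P.a := Real.sqrt_pos.2 ha
    rw [← div_eq_inv_mul, le_div_iff₀ hs]
    refine abs_le_of_sq_le_sq' ?_ (norm_nonneg _) |>.2
    have : 0 ≤ ‖X.v‖ ^ 2 + ‖X.z‖ ^ 2 + ‖X.yx‖ ^ 2 := by positivity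
    rw [mul_pow, Real.sq_sqrt ha.le]
    linarith [norm_sq X]
  have b5 (X : P.EnergySpace) : ‖X.u‖ ≤ |C| * (√P.a)⁻¹ * ‖X‖ := by
    have h := hC _ X.u_mem
    have h' := mul_le_mul_of_nonneg_left (b4 X) (abs_nonneg C)
    have h'' := mul_le_mul_of_nonneg_right (le_abs_self C) (norm_nonneg X.ux)
    rw [mul_assoc]
    exact (h.trans h'').trans h'
  have b6 (X : P.EnergySpace) : ‖X.y‖ ≤ |C| * ‖X‖ := by
    have h := hC _ X.y_mem
    have h' := mul_le_mul_of_nonneg_left (b3 X) (abs_nonneg C)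
    have h'' := mul_le_mul_of_nonneg_right (le_abs_self C) (norm_nonneg X.yx)
    rw [one_mul] at h'
    exact (h.trans h'').trans h'
  obtain ⟨v, hv⟩ := lim (AddMonoidHom.mk' EnergySpace.v v_add) _ b1
  obtain ⟨z, hz⟩ := lim (AddMonoidHom.mk' EnergySpace.z z_add) _ b2
  obtain ⟨yx, hyx⟩ := lim (AddMonoidHom.mk' EnergySpace.yx yx_add) _ b3
  obtain ⟨ux, hux⟩ := lim (AddMonoidHom.mk' EnergySpace.ux ux_add) _ b4
  obtain ⟨u, hu⟩ := lim (AddMonoidHom.mk' EnergySpace.u u_add) _ b5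
  obtain ⟨y, hy⟩ := lim (AddMonoidHom.mk' EnergySpace.y y_add) _ b6
  have mu : (u, ux) ∈ (testGraph P.L).topologicalClosure :=
    (testGraph P.L).isClosed_topologicalClosure.mem_of_tendsto (hu.prodMk_nhds hux)
      (Eventually.of_forall fun n => mem_closure_of_mem_H10 (U n).u_mem)
  have my : (y, yx) ∈ (testGraph P.L).topologicalClosure :=
    (testGraph P.L).isClosed_topologicalClosure.mem_of_tendsto (hy.prodMk_nhds hyx)
      (Eventually.of_forall fun n => mem_closure_of_mem_H10 (U n).y_mem)
  let X : P.EnergySpace := mk ⟨u, _, mu, rfl⟩ v ⟨y, _, my, rfl⟩ z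
  have eu : X.ux = ux := (hasWeakDeriv_of_mem_closure mu).weakDeriv_eq
  have ey : X.yx = yx := (hasWeakDeriv_of_mem_closure my).weakDeriv_eq
  refine ⟨X, ?_⟩
  have t {f : ℕ → L2 P.L} {g : L2 P.L} (h : Tendsto f atTop (𝓝 g)) :
      Tendsto (fun n => ‖f n - g‖ ^ 2) atTop (𝓝 0) := by
    simpa using (tendsto_iff_norm_sub_tendsto_zero.1 h).pow 2
  have key : Tendsto (fun n => ‖U n - X‖ ^ 2) atTop (𝓝 0) := by
    have := (((t hv).add ((t hux).const_mul P.a)).add (t hz)).add (t hyx)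
    simp only [mul_zero, add_zero] at this
    refine this.congr fun n => ?_
    rw [norm_sq, sub_eq_add_neg (U n) X, ← neg_one_smul ℂ X, v_add, ux_add, z_add, yx_add,
      v_smul, ux_smul, z_smul, yx_smul, eu, ey, neg_one_smul, neg_one_smul, neg_one_smul,
      neg_one_smul, ← sub_eq_add_neg, ← sub_eq_add_neg, ← sub_eq_add_neg, ← sub_eq_add_neg]
    rfl
  rw [tendsto_iff_norm_sub_tendsto_zero]
  simpa using key.sqrt

end EnergySpace

open EnergySpace

/-- The stress `a u_x + b(x) v_x`. -/
def stress (U : P.EnergySpace) : L2 P.L := (P.a : ℂ) • U.ux + P.mulB (weakDeriv P.L U.v)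

theorem stress_add {U V : P.EnergySpace} (hU : U.v ∈ H10 P.L) (hV : V.v ∈ H10 P.L) :
    P.stress (U + V) = P.stress U + P.stress V := by
  simp only [stress, ux_add, v_add, weakDeriv_add (H10_le_H1 _ hU) (H10_le_H1 _ hV), map_add,
    smul_add]
  abel

theorem stress_smul (c : ℂ) {U : P.EnergySpace} (hU : U.v ∈ H10 P.L) :
    P.stress (c • U) = c • P.stress U := by
  simp only [stress, ux_smul, v_smul, weakDeriv_smul c (H10_le_H1 _ hU), map_smul, smul_add,
    smul_comm c]

/-- The domain `D(A)`: the `(u, v, y, z)` in the energy space with `y ∈ H² ∩ H¹₀`, `v, z ∈ H¹₀` and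
`(a u_x + b(x) v_x)_x ∈ L²`. -/
def domainA : Submodule ℂ P.EnergySpace where
  carrier := {U | U.y ∈ H2 P.L ∧ U.v ∈ H10 P.L ∧ U.z ∈ H10 P.L ∧ P.stress U ∈ H1 P.L}
  zero_mem' := by
    have h : (0 : P.EnergySpace).v = 0 := rfl
    have hs : P.stress 0 = 0 := by
      have := P.stress_smul 0 (U := 0) (by rw [h]; exact zero_mem _)
      simpa using this
    exact ⟨zero_mem _, zero_mem _, zero_mem _, by rw [hs]; exact zero_mem _⟩
  add_mem' := by
    rintro U V ⟨h1, h2, h3, h4⟩ ⟨k1, k2, k3, k4⟩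
    exact ⟨add_mem h1 k1, add_mem h2 k2, add_mem h3 k3, by
      rw [P.stress_add h2 k2]; exact add_mem h4 k4⟩
  smul_mem' := by
    rintro c U ⟨h1, h2, h3, h4⟩
    exact ⟨Submodule.smul_mem _ c h1, Submodule.smul_mem _ c h2, Submodule.smul_mem _ c h3, by
      rw [P.stress_smul c h2]; exact Submodule.smul_mem _ c h4⟩

theorem opA_aux₁ {U V : P.EnergySpace} (hU : U ∈ P.domainA) (hV : V ∈ P.domainA) :
    weakDeriv P.L (P.stress (U + V)) - P.mulC (U + V).z =
      (weakDeriv P.L (P.stress U) - P.mulC U.z) + (weakDeriv P.L (P.stress V) - P.mulC V.z) := by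
  rw [P.stress_add hU.2.1 hV.2.1, weakDeriv_add hU.2.2.2 hV.2.2.2, z_add, map_add]
  abel

theorem opA_aux₂ {U V : P.EnergySpace} (hU : U ∈ P.domainA) (hV : V ∈ P.domainA) :
    weakDeriv P.L (U + V).yx + P.mulC (U + V).v =
      (weakDeriv P.L U.yx + P.mulC U.v) + (weakDeriv P.L V.yx + P.mulC V.v) := by
  have h1 : U.yx ∈ H1 P.L := hU.1.2
  have h2 : V.yx ∈ H1 P.L := hV.1.2
  rw [yx_add, weakDeriv_add h1 h2, v_add, map_add]
  abel

theorem opA_aux₃ (c : ℂ) {U : P.EnergySpace} (hU : U ∈ P.domainA) :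
    weakDeriv P.L (P.stress (c • U)) - P.mulC (c • U).z =
      c • (weakDeriv P.L (P.stress U) - P.mulC U.z) := by
  rw [P.stress_smul c hU.2.1, weakDeriv_smul c hU.2.2.2, z_smul, map_smul, smul_sub]

theorem opA_aux₄ (c : ℂ) {U : P.EnergySpace} (hU : U ∈ P.domainA) :
    weakDeriv P.L (c • U).yx + P.mulC (c • U).v =
      c • (weakDeriv P.L U.yx + P.mulC U.v) := by
  have h1 : U.yx ∈ H1 P.L := hU.1.2
  rw [yx_smul, weakDeriv_smul c h1, v_smul, map_smul, smul_add]

/-- The operator `A (u, v, y, z) = (v, (a u_x + b(x) v_x)_x - c(x) z, z, y_xx + c(x) v)` with domain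
`D(A)`. -/
def opA : P.EnergySpace →ₗ.[ℂ] P.EnergySpace where
  domain := P.domainA
  toFun :=
    { toFun := fun U => EnergySpace.mk
        ⟨(U : P.EnergySpace).v, U.2.2.1⟩
        (weakDeriv P.L (P.stress U) - P.mulC (U : P.EnergySpace).z)
        ⟨(U : P.EnergySpace).z, U.2.2.2.1⟩
        (weakDeriv P.L (U : P.EnergySpace).yx + P.mulC (U : P.EnergySpace).v)
      map_add' := fun U V => EnergySpace.ext' (v_add _ _)
        (P.opA_aux₁ U.2 V.2) (z_add _ _) (P.opA_aux₂ U.2 V.2)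
      map_smul' := fun c U => EnergySpace.ext' (v_smul _ _)
        (P.opA_aux₃ c U.2) (z_smul _ _) (P.opA_aux₄ c U.2) }

end WaveData

end

/-! This is the Lumer–Phillips theorem applied to the wave system, followed by uniqueness of weak
solutions. Dissipativity: integrating by parts, the elastic terms cancel in the real part. The
coupling terms cancel too, because multiplication by `c` is symmetric. Only `-∫ b |v_x|²` remains
(`isDissipative_opA`). Range condition: the equations for `u` and `y` are algebraic. Eliminating
these unknowns leaves a coercive variational problem for `(v, z)` in `H¹₀ × H¹₀`, solved by
Lax–Milgram. Testing with smooth functions then yields the regularity required by the domain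
(`surjective_smul_sub_opA`). Semigroup: the exponentials of the Yosida approximations are
contractions and commute. They converge on the dense domain, hence everywhere
(`cauchySeq_exp_yosida`), and the integrated equation passes to the limit
(`semigroup_eq_add_integral`). Uniqueness: the time integral of a weak solution with zero data takes
values in `D(A)` and solves the equation strongly, so dissipativity makes it vanish
(`eq_zero_of_isWeakSolution`). Weak existence follows from the strong case by density. -/

noncomputable section

/-! ### Dissipative operators and their resolvents. -/

section AbstractEvolution

variable {E : Type*} [NormedAddCommGroup E] [InnerProductSpace ℂ E] {A : E →ₗ.[ℂ] E}

theorem IsDissipative.re_inner_le_zero (hA : IsDissipative A) {X Y : E} (h : (X, Y) ∈ A.graph) :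
    (⟪Y, X⟫_ℂ).re ≤ 0 := by
  obtain ⟨U, rfl, rfl⟩ := (LinearPMap.mem_graph_iff A).1 h
  exact hA U

/-- Pair `r X - Y` with `X` and apply Cauchy–Schwarz. This yields both the injectivity of `r I - A`
and the bound `1 / r` on its inverse. -/
theorem IsDissipative.mul_norm_le (hA : IsDissipative A) {r : ℝ} {X Y : E}
    (h : (X, Y) ∈ A.graph) : r * ‖X‖ ≤ ‖(r : ℂ) • X - Y‖ := by
  have h1 : r * ‖X‖ ^ 2 ≤ (⟪(r : ℂ) • X - Y, X⟫_ℂ).re := by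
    have h2 := hA.re_inner_le_zero h
    have h3 : (⟪X, X⟫_ℂ).re = ‖X‖ ^ 2 := inner_self_eq_norm_sq (𝕜 := ℂ) X
    rw [inner_sub_left, inner_smul_left, Complex.conj_ofReal, Complex.sub_re,
      Complex.re_ofReal_mul, h3]
    linarith
  have h4 : (⟪(r : ℂ) • X - Y, X⟫_ℂ).re ≤ ‖(r : ℂ) • X - Y‖ * ‖X‖ :=
    re_inner_le_norm (𝕜 := ℂ) _ _
  rcases (norm_nonneg X).eq_or_lt with h0 | h0
  · rw [← h0, mul_zero]; exact norm_nonneg _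
  · refine le_of_mul_le_mul_right ?_ h0
    rw [mul_assoc, ← sq]
    exact h1.trans h4

namespace IsMDissipative

/-- `r I - A` as a linear equivalence `D(A) ≃ E`. -/
def resolventEquiv (hA : IsMDissipative A) (r : ℝ) (hr : 0 < r) : A.domain ≃ₗ[ℂ] E :=
  LinearEquiv.ofBijective ((r : ℂ) • A.domain.subtype - A.toFun) <| by
    refine ⟨(injective_iff_map_eq_zero _).2 fun U hU => ?_, fun F => hA.2 r hr F⟩
    have h := hA.1.mul_norm_le (r := r) (A.mem_graph U)
    have h0 : (r : ℂ) • (U : E) - A U = 0 := hU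
    rw [h0, norm_zero] at h
    exact Subtype.ext (norm_le_zero_iff.1 (nonpos_of_mul_nonpos_right h hr))

theorem resolventEquiv_symm_graph (hA : IsMDissipative A) {r : ℝ} (hr : 0 < r) (F : E) :
    (((hA.resolventEquiv r hr).symm F : E), (r : ℂ) • ((hA.resolventEquiv r hr).symm F : E) - F)
      ∈ A.graph := by
  refine (LinearPMap.mem_graph_iff A).2 ⟨_, rfl, ?_⟩
  have h : (r : ℂ) • ((hA.resolventEquiv r hr).symm F : E) - A ((hA.resolventEquiv r hr).symm F)
    = F := (hA.resolventEquiv r hr).apply_symm_apply F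
  dsimp only
  -- The first two occurrences of `F` are arguments of the inverse; only the bare one is to be
  -- replaced.
  nth_rw 3 [← h]
  abel

/-- The resolvent `(r I - A)⁻¹`. -/
def resolvent (hA : IsMDissipative A) (r : ℝ) (hr : 0 < r) : E →L[ℂ] E :=
  (A.domain.subtype ∘ₗ (hA.resolventEquiv r hr).symm.toLinearMap).mkContinuous r⁻¹ fun F => by
    have h := hA.1.mul_norm_le (r := r) (hA.resolventEquiv_symm_graph hr F)
    rw [sub_sub_cancel] at h
    rwa [← div_eq_inv_mul, le_div_iff₀' hr]

variable (hA : IsMDissipative A) {r : ℝ} (hr : 0 < r)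

theorem resolvent_graph (F : E) :
    (hA.resolvent r hr F, (r : ℂ) • hA.resolvent r hr F - F) ∈ A.graph :=
  hA.resolventEquiv_symm_graph hr F

theorem resolvent_apply {X Y : E} (h : (X, Y) ∈ A.graph) :
    hA.resolvent r hr ((r : ℂ) • X - Y) = X := by
  obtain ⟨U, rfl, rfl⟩ := (LinearPMap.mem_graph_iff A).1 h
  exact congrArg Subtype.val ((hA.resolventEquiv r hr).symm_apply_apply U)

theorem mul_norm_resolvent_le (F : E) : r * ‖hA.resolvent r hr F‖ ≤ ‖F‖ := by
  have h := hA.1.mul_norm_le (r := r) (hA.resolvent_graph hr F)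
  rwa [sub_sub_cancel] at h

theorem resolvent_sub_apply {X Y : E} (h : (X, Y) ∈ A.graph) :
    (r : ℂ) • hA.resolvent r hr X - X = hA.resolvent r hr Y := by
  have := hA.resolvent_apply hr h
  rw [map_sub, map_smul] at this
  rw [← sub_eq_zero, sub_right_comm, this, sub_self]

/-- By the resolvent identity, both products multiplied by `r - s` equal the difference of the two
resolvents applied to `F`. -/
theorem commute_resolvent {s : ℝ} (hs : 0 < s) :
    Commute (hA.resolvent r hr) (hA.resolvent s hs) := by
  by_cases hrs : r = s
  · subst hrs; exact Commute.refl _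
  ext F
  change hA.resolvent r hr (hA.resolvent s hs F) = hA.resolvent s hs (hA.resolvent r hr F)
  have h1 := hA.resolvent_apply hr (hA.resolvent_graph hs F)
  have h2 := hA.resolvent_apply hs (hA.resolvent_graph hr F)
  simp only [map_sub, map_smul] at h1 h2
  set a := hA.resolvent r hr (hA.resolvent s hs F)
  set b := hA.resolvent s hs (hA.resolvent r hr F)
  have h3 : ((r : ℂ) - s) • (a - b) = 0 := by
    have e : ((r : ℂ) - s) • (a - b) = ((r : ℂ) • a - ((s : ℂ) • a - hA.resolvent r hr F)) +
      ((s : ℂ) • b - ((r : ℂ) • b - hA.resolvent s hs F)) - hA.resolvent r hr F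
        - hA.resolvent s hs F := by
      module
    rw [e, h1, h2]
    abel
  have h4 : ((r : ℂ) - s) ≠ 0 := sub_ne_zero.2 (by exact_mod_cast hrs)
  exact sub_eq_zero.1 ((smul_eq_zero.1 h3).resolve_left h4)

/-- If `W` is orthogonal to the domain, solve `X - A X = W`. Dissipativity and `⟪W, X⟫ = 0` force `X
= 0`, hence `W = 0`. -/
theorem dense_domain [CompleteSpace E] (hA : IsMDissipative A) : Dense (A.domain : Set E) := by
  rw [Submodule.dense_iff_topologicalClosure_eq_top, Submodule.topologicalClosure_eq_top_iff,
    Submodule.eq_bot_iff]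
  intro W hW
  have hg := hA.resolvent_graph one_pos W
  set X := hA.resolvent 1 one_pos W
  have hX : X ∈ A.domain := LinearPMap.mem_domain_of_mem_graph hg
  have h0 : ⟪W, X⟫_ℂ = 0 := (Submodule.mem_orthogonal' _ _).1 hW X hX
  have h1 := hA.1.re_inner_le_zero hg
  rw [inner_sub_left, h0, sub_zero, Complex.ofReal_one, one_smul] at h1
  have h3 : (⟪X, X⟫_ℂ).re = ‖X‖ ^ 2 := inner_self_eq_norm_sq (𝕜 := ℂ) X
  have h4 : X = 0 := by
    rw [h3] at h1
    simpa using le_antisymm h1 (sq_nonneg _)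
  rw [h4, smul_zero, zero_sub] at hg
  have h5 := A.graph_fst_eq_zero_snd hg rfl
  simpa using h5

end IsMDissipative

/-- The norm of a solution of a dissipative evolution equation does not grow. -/
theorem norm_le_of_re_inner_deriv_nonpos {f f' : ℝ → E}
    (hf : ∀ t, 0 ≤ t → HasDerivWithinAt f (f' t) (Ici 0) t)
    (hd : ∀ t, 0 ≤ t → (⟪f' t, f t⟫_ℂ).re ≤ 0) {t : ℝ} (ht : 0 ≤ t) : ‖f t‖ ≤ ‖f 0‖ := by
  have hn (s : ℝ) : (⟪f s, f s⟫_ℂ).re = ‖f s‖ ^ 2 := inner_self_eq_norm_sq (𝕜 := ℂ) _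
  have hder (s : ℝ) (hs : 0 ≤ s) : HasDerivWithinAt (fun s => ‖f s‖ ^ 2)
      (⟪f s, f' s⟫_ℂ + ⟪f' s, f s⟫_ℂ).re (Ici 0) s := by
    have h1 := (hf s hs).inner ℂ (hf s hs)
    have h2 := Complex.reCLM.hasFDerivAt.comp_hasDerivWithinAt s h1
    refine h2.congr_of_mem (fun x _ => ?_) hs
    exact (hn x).symm
  have hanti : AntitoneOn (fun s => ‖f s‖ ^ 2) (Ici 0) := by
    refine antitoneOn_of_deriv_nonpos (convex_Ici 0) (fun s hs => (hder s hs).continuousWithinAt)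
      (fun s hs => ?_) (fun s hs => ?_)
    · rw [interior_Ici] at hs ⊢
      exact ((hder s (le_of_lt hs)).mono Ioi_subset_Ici_self).differentiableWithinAt
    · rw [interior_Ici] at hs
      rw [((hder s (le_of_lt hs)).hasDerivAt (Ici_mem_nhds hs)).deriv, Complex.add_re]
      have h3 : (⟪f s, f' s⟫_ℂ).re = (⟪f' s, f s⟫_ℂ).re := inner_re_symm (𝕜 := ℂ) _ _
      have := hd s (le_of_lt hs)
      linarith
  exact abs_le_of_sq_le_sq' (hanti self_mem_Ici ht ht) (norm_nonneg _) |>.2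

end AbstractEvolution

/-! ### Exponentials of bounded dissipative operators. -/

section BoundedSemigroup

variable {E : Type*} [NormedAddCommGroup E] [InnerProductSpace ℂ E]

theorem tendsto_of_dense_of_norm_le {B : ℕ → E →L[ℂ] E} {L : E →L[ℂ] E}
    (hB : ∀ n x, ‖B n x‖ ≤ ‖x‖) {D : Set E} (hD : Dense D)
    (h : ∀ x ∈ D, Tendsto (fun n => B n x) atTop (𝓝 (L x))) (x : E) :
    Tendsto (fun n => B n x) atTop (𝓝 (L x)) := by
  have hequi : Equicontinuous fun n => (B n : E → E) := by
    refine LipschitzWith.uniformEquicontinuous _ 1 (fun n => ?_) |>.equicontinuous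
    refine LipschitzWith.of_dist_le_mul fun a b => ?_
    rw [dist_eq_norm, dist_eq_norm, ← map_sub, NNReal.coe_one, one_mul]
    exact hB n _
  exact hequi.isClosed_setOfPred_tendsto L.continuous |>.closure_subset_iff.2 h (hD x)

theorem cauchySeq_of_dense_of_norm_le {B : ℕ → E →L[ℂ] E}
    (hB : ∀ n x, ‖B n x‖ ≤ ‖x‖) {D : Set E} (hD : Dense D)
    (h : ∀ x ∈ D, CauchySeq fun n => B n x) (x : E) : CauchySeq fun n => B n x := by
  rw [Metric.cauchySeq_iff]
  intro ε hε
  obtain ⟨y, hy, hxy⟩ := hD.exists_dist_lt x (ε := ε / 3) (by positivity)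
  obtain ⟨N, hN⟩ := Metric.cauchySeq_iff.1 (h y hy) (ε / 3) (by positivity)
  have hdist (n : ℕ) : dist (B n x) (B n y) < ε / 3 := by
    rw [dist_eq_norm, ← map_sub]
    exact (hB n _).trans_lt (by rwa [← dist_eq_norm])
  refine ⟨N, fun m hm n hn => ?_⟩
  have h1 := dist_triangle4 (B m x) (B m y) (B n y) (B n x)
  have h2 := hN m hm n hn
  have h3 := hdist m
  have h4 := hdist n
  rw [dist_comm] at h4
  linarith

variable [CompleteSpace E]

theorem hasDerivAt_exp_smul_apply (B : E →L[ℂ] E) (x : E) (t : ℝ) :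
    HasDerivAt (fun s : ℝ => NormedSpace.exp (s • B) x) (NormedSpace.exp (t • B) (B x)) t :=
  ((ContinuousLinearMap.apply ℂ E x).restrictScalars ℝ).hasFDerivAt.comp_hasDerivAt t
    (hasDerivAt_exp_smul_const (𝕂 := ℝ) B t)

/-- The bound does not involve `‖B‖`, so it holds uniformly along the Yosida approximations, whose
norms need not be bounded. -/
theorem norm_exp_smul_apply_le {B : E →L[ℂ] E} (hB : ∀ x, (⟪B x, x⟫_ℂ).re ≤ 0) {t : ℝ}
    (ht : 0 ≤ t) (x : E) : ‖NormedSpace.exp (t • B) x‖ ≤ ‖x‖ := by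
  have hc (s : ℝ) : NormedSpace.exp (s • B) (B x) = B (NormedSpace.exp (s • B) x) :=
    congrArg (fun T : E →L[ℂ] E => T x)
      (((Commute.refl B).smul_left s).exp_left : Commute (NormedSpace.exp (s • B)) B).eq
  have h := norm_le_of_re_inner_deriv_nonpos
    (fun s _ => (hasDerivAt_exp_smul_apply B x s).hasDerivWithinAt)
    (fun s _ => by rw [hc]; exact hB _) ht
  simpa using h

/-- Interpolate by `s ↦ exp (s B) exp ((t - s) C) x`. Commutation moves `B - C` next to `x` in the
derivative, so the two contractions leave only `‖B x - C x‖` and no operator norm. -/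
theorem norm_exp_smul_sub_exp_smul_le {B C : E →L[ℂ] E} (hB : ∀ x, (⟪B x, x⟫_ℂ).re ≤ 0)
    (hC : ∀ x, (⟪C x, x⟫_ℂ).re ≤ 0) (hBC : Commute B C) {t : ℝ} (ht : 0 ≤ t) (x : E) :
    ‖NormedSpace.exp (t • B) x - NormedSpace.exp (t • C) x‖ ≤ t * ‖B x - C x‖ := by
  have hder (s : ℝ) : HasDerivAt
      (fun s : ℝ => (NormedSpace.exp (s • B) * NormedSpace.exp ((t - s) • C)) x)
      (NormedSpace.exp (s • B) (NormedSpace.exp ((t - s) • C) (B x - C x))) s := by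
    have h1 := hasDerivAt_exp_smul_const (𝕂 := ℝ) B s
    have h2 := (hasDerivAt_exp_smul_const (𝕂 := ℝ) C (t - s)).scomp s
      ((hasDerivAt_id s).const_sub t)
    have h3 := ((ContinuousLinearMap.apply ℂ E x).restrictScalars ℝ).hasFDerivAt.comp_hasDerivAt s
      (h1.mul h2)
    refine HasDerivAt.congr_deriv (f := fun s : ℝ =>
      (NormedSpace.exp (s • B) * NormedSpace.exp ((t - s) • C)) x) h3 ?_
    have hc : B * NormedSpace.exp ((t - s) • C) = NormedSpace.exp ((t - s) • C) * B :=
      ((hBC.smul_right (t - s)).exp_right : Commute B (NormedSpace.exp ((t - s) • C))).eq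
    have e : NormedSpace.exp (s • B) * B * NormedSpace.exp ((t - s) • C) +
        NormedSpace.exp (s • B) * ((-1 : ℝ) • (NormedSpace.exp ((t - s) • C) * C)) =
        NormedSpace.exp (s • B) * (NormedSpace.exp ((t - s) • C) * (B - C)) := by
      rw [mul_assoc, hc, ← mul_add, neg_one_smul, ← sub_eq_add_neg, ← mul_sub]
    exact congrArg (fun T : E →L[ℂ] E => T x) e
  have h := norm_image_sub_le_of_norm_deriv_le_segment' (a := 0) (b := t) (C := ‖B x - C x‖)
    (fun s _ => (hder s).hasDerivWithinAt) (fun s hs => ?_) t ⟨ht, le_rfl⟩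
  · simpa [mul_comm] using h
  · exact (norm_exp_smul_apply_le hB hs.1 _).trans
      (norm_exp_smul_apply_le hC (sub_nonneg.2 hs.2.le) _)

theorem norm_exp_smul_sub_le {B : E →L[ℂ] E} (hB : ∀ x, (⟪B x, x⟫_ℂ).re ≤ 0) {s t : ℝ}
    (hs : 0 ≤ s) (ht : 0 ≤ t) (x : E) :
    ‖NormedSpace.exp (t • B) x - NormedSpace.exp (s • B) x‖ ≤ ‖B x‖ * ‖t - s‖ :=
  (convex_Ici (0 : ℝ)).norm_image_sub_le_of_norm_hasDerivWithin_le
    (fun r _ => (hasDerivAt_exp_smul_apply B x r).hasDerivWithinAt)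
    (fun _ hr => norm_exp_smul_apply_le hB hr _) hs ht

theorem exp_add_smul (B : E →L[ℂ] E) (s t : ℝ) :
    NormedSpace.exp ((s + t) • B) = NormedSpace.exp (s • B) * NormedSpace.exp (t • B) := by
  let : NormedAlgebra ℚ (E →L[ℂ] E) := NormedAlgebra.restrictScalars ℚ ℝ _
  rw [add_smul]
  exact NormedSpace.exp_add_of_commute (((Commute.refl B).smul_left s).smul_right t)

end BoundedSemigroup

/-! ### Yosida approximation and the contraction semigroup. -/

namespace IsMDissipative

variable {E : Type*} [NormedAddCommGroup E] [InnerProductSpace ℂ E] {A : E →ₗ.[ℂ] E}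
variable (hA : IsMDissipative A)

/-- The Yosida approximation `r A (r I - A)⁻¹` for `r = n + 1`. -/
def yosida (n : ℕ) : E →L[ℂ] E :=
  ((n + 1 : ℝ) : ℂ) •
    (((n + 1 : ℝ) : ℂ) • hA.resolvent (n + 1) n.cast_add_one_pos - ContinuousLinearMap.id ℂ E)

/-- Since `r (r I - A)⁻¹` is a contraction, subtracting the identity leaves a dissipative operator.
-/
theorem re_inner_yosida_le_zero (n : ℕ) (x : E) : (⟪hA.yosida n x, x⟫_ℂ).re ≤ 0 := by
  have hr : (0 : ℝ) < n + 1 := n.cast_add_one_pos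
  change (⟪((n + 1 : ℝ) : ℂ) • (((n + 1 : ℝ) : ℂ) • hA.resolvent (n + 1) hr x - x), x⟫_ℂ).re ≤ 0
  generalize (n + 1 : ℝ) = r at hr
  have h3 : (⟪x, x⟫_ℂ).re = ‖x‖ ^ 2 := inner_self_eq_norm_sq (𝕜 := ℂ) x
  have h4 : (⟪hA.resolvent r hr x, x⟫_ℂ).re ≤ ‖hA.resolvent r hr x‖ * ‖x‖ :=
    re_inner_le_norm (𝕜 := ℂ) _ _
  have h5 := mul_le_mul_of_nonneg_right (hA.mul_norm_resolvent_le hr x) (norm_nonneg x)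
  rw [inner_smul_left, inner_sub_left, inner_smul_left, Complex.conj_ofReal,
    Complex.re_ofReal_mul, Complex.sub_re, Complex.re_ofReal_mul, h3]
  refine mul_nonpos_of_nonneg_of_nonpos hr.le ?_
  have h6 := mul_le_mul_of_nonneg_left h4 hr.le
  linarith

theorem commute_yosida (m n : ℕ) : Commute (hA.yosida m) (hA.yosida n) := by
  have h := hA.commute_resolvent (m.cast_add_one_pos (α := ℝ)) (n.cast_add_one_pos (α := ℝ))
  exact ((((h.smul_left _).smul_right _).sub_left (Commute.one_left _)).sub_right
    (Commute.one_right _)).smul_left _ |>.smul_right _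

theorem yosida_apply_of_mem_graph {X Y : E} (h : (X, Y) ∈ A.graph) (n : ℕ) :
    hA.yosida n X = ((n + 1 : ℝ) : ℂ) • hA.resolvent (n + 1) n.cast_add_one_pos Y :=
  congrArg (((n + 1 : ℝ) : ℂ) • ·) (hA.resolvent_sub_apply n.cast_add_one_pos h)

theorem norm_smul_resolvent_le {r : ℝ} (hr : 0 < r) (F : E) :
    ‖(r : ℂ) • hA.resolvent r hr F‖ ≤ ‖F‖ := by
  rw [norm_smul, Complex.norm_real, Real.norm_of_nonneg hr.le]
  exact hA.mul_norm_resolvent_le hr F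

theorem norm_yosida_le_of_mem_graph {X Y : E} (h : (X, Y) ∈ A.graph) (n : ℕ) :
    ‖hA.yosida n X‖ ≤ ‖Y‖ := by
  rw [hA.yosida_apply_of_mem_graph h]
  exact hA.norm_smul_resolvent_le _ Y

variable [CompleteSpace E]

/-- On the domain the error is the resolvent applied to `A x`, of size at most `‖A x‖ / (n + 1)`.
Uniform boundedness extends the limit to all `x`. -/
theorem tendsto_smul_resolvent (x : E) :
    Tendsto (fun n : ℕ => ((n + 1 : ℝ) : ℂ) • hA.resolvent (n + 1) n.cast_add_one_pos x) atTop
      (𝓝 x) := by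
  refine tendsto_of_dense_of_norm_le
    (B := fun n : ℕ => ((n + 1 : ℝ) : ℂ) • hA.resolvent (n + 1) n.cast_add_one_pos)
    (L := ContinuousLinearMap.id ℂ E) (fun n x => hA.norm_smul_resolvent_le _ x)
    hA.dense_domain (fun x hx => ?_) x
  have hg : (x, A ⟨x, hx⟩) ∈ A.graph := A.mem_graph ⟨x, hx⟩
  rw [tendsto_iff_norm_sub_tendsto_zero]
  refine squeeze_zero (fun n => norm_nonneg _) (g := fun n : ℕ => ‖A ⟨x, hx⟩‖ / ((n : ℝ) + 1))
    (fun n => ?_) (by simpa [div_eq_mul_inv] using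
      tendsto_one_div_add_atTop_nhds_zero_nat.const_mul ‖A ⟨x, hx⟩‖)
  rw [le_div_iff₀' n.cast_add_one_pos]
  have h := hA.mul_norm_resolvent_le n.cast_add_one_pos (A ⟨x, hx⟩)
  rwa [← hA.resolvent_sub_apply _ hg] at h

theorem tendsto_yosida {X Y : E} (h : (X, Y) ∈ A.graph) :
    Tendsto (fun n => hA.yosida n X) atTop (𝓝 Y) := by
  simp only [hA.yosida_apply_of_mem_graph h]
  exact hA.tendsto_smul_resolvent Y

theorem cauchySeq_exp_yosida {t : ℝ} (ht : 0 ≤ t) (x : E) :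
    CauchySeq fun n => NormedSpace.exp (t • hA.yosida n) x := by
  refine cauchySeq_of_dense_of_norm_le
    (fun n x => norm_exp_smul_apply_le (hA.re_inner_yosida_le_zero n) ht x) hA.dense_domain
    (fun x hx => ?_) x
  have hc := (hA.tendsto_yosida (A.mem_graph ⟨x, hx⟩)).cauchySeq
  rw [Metric.cauchySeq_iff] at hc ⊢
  intro ε hε
  -- The denominator is `t + 1` rather than `t` because `t = 0` is allowed.
  obtain ⟨N, hN⟩ := hc (ε / (t + 1)) (by positivity)
  refine ⟨N, fun m hm n hn => ?_⟩
  have h1 := norm_exp_smul_sub_exp_smul_le (hA.re_inner_yosida_le_zero m)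
    (hA.re_inner_yosida_le_zero n) (hA.commute_yosida m n) ht x
  have h2 := hN m hm n hn
  rw [dist_eq_norm, lt_div_iff₀ (by positivity)] at h2
  rw [dist_eq_norm]
  have h3 := norm_nonneg (hA.yosida m x - hA.yosida n x)
  change ‖hA.yosida m x - hA.yosida n x‖ * (t + 1) < ε at h2
  nlinarith

/-- Clamping the time at `0` provides a limit for every real `t`. Convergence in the function space
`E → E` is pointwise, the form from which the limit is known to be a bounded operator. -/
theorem exists_tendsto_exp_yosida (t : ℝ) : ∃ f : E → E,
    Tendsto (fun n x => NormedSpace.exp (max t 0 • hA.yosida n) x) atTop (𝓝 f) := by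
  choose f hf using fun x => cauchySeq_tendsto_of_complete
    (hA.cauchySeq_exp_yosida (le_max_right t 0) x)
  exact ⟨f, tendsto_pi_nhds.2 hf⟩

/-- The contraction semigroup generated by an m-dissipative operator, extended by the identity to
negative times. -/
def semigroup (t : ℝ) : E →L[ℂ] E :=
  continuousLinearMapOfTendsto _ (hA.exists_tendsto_exp_yosida t).choose_spec

theorem tendsto_semigroup {t : ℝ} (ht : 0 ≤ t) (x : E) :
    Tendsto (fun n => NormedSpace.exp (t • hA.yosida n) x) atTop (𝓝 (hA.semigroup t x)) := by
  have h : Tendsto (fun n => NormedSpace.exp (max t 0 • hA.yosida n) x) atTop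
      (𝓝 (hA.semigroup t x)) :=
    tendsto_pi_nhds.1 (hA.exists_tendsto_exp_yosida t).choose_spec x
  rw [max_eq_left ht] at h
  exact h

theorem semigroup_of_nonpos {t : ℝ} (ht : t ≤ 0) (x : E) : hA.semigroup t x = x := by
  have h : Tendsto (fun n => NormedSpace.exp (max t 0 • hA.yosida n) x) atTop
      (𝓝 (hA.semigroup t x)) :=
    tendsto_pi_nhds.1 (hA.exists_tendsto_exp_yosida t).choose_spec x
  rw [max_eq_right ht] at h
  simp only [zero_smul, NormedSpace.exp_zero] at h
  exact tendsto_nhds_unique h tendsto_const_nhds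

theorem semigroup_max (t : ℝ) : hA.semigroup (max t 0) = hA.semigroup t := by
  rcases le_total t 0 with h | h
  · ext x
    rw [max_eq_right h, hA.semigroup_of_nonpos h, hA.semigroup_of_nonpos le_rfl]
  · rw [max_eq_left h]

theorem norm_semigroup_apply_le (t : ℝ) (x : E) : ‖hA.semigroup t x‖ ≤ ‖x‖ := by
  rw [← semigroup_max]
  exact le_of_tendsto (hA.tendsto_semigroup (le_max_right t 0) x).norm (Eventually.of_forall
    fun n => norm_exp_smul_apply_le (hA.re_inner_yosida_le_zero n) (le_max_right t 0) x)

theorem semigroup_add {s t : ℝ} (hs : 0 ≤ s) (ht : 0 ≤ t) :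
    hA.semigroup (s + t) = (hA.semigroup s).comp (hA.semigroup t) := by
  ext x
  refine tendsto_nhds_unique (hA.tendsto_semigroup (add_nonneg hs ht) x) ?_
  have h1 := hA.tendsto_semigroup hs (hA.semigroup t x)
  -- The inner argument also varies with `n`; the outer contraction controls the error of replacing
  -- it by its limit.
  have h2 : Tendsto (fun n => NormedSpace.exp (s • hA.yosida n)
      (NormedSpace.exp (t • hA.yosida n) x - hA.semigroup t x)) atTop (𝓝 0) := by
    refine squeeze_zero_norm (fun n => norm_exp_smul_apply_le (hA.re_inner_yosida_le_zero n) hs _)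
      (tendsto_iff_norm_sub_tendsto_zero.1 (hA.tendsto_semigroup ht x))
  have h3 := h1.add h2
  rw [add_zero] at h3
  refine h3.congr fun n => ?_
  rw [map_sub, add_sub_cancel, exp_add_smul]
  rfl

theorem norm_semigroup_sub_le {X Y : E} (h : (X, Y) ∈ A.graph) (s t : ℝ) :
    ‖hA.semigroup t X - hA.semigroup s X‖ ≤ ‖Y‖ * |t - s| := by
  have hs := le_max_right s 0
  have ht := le_max_right t 0
  rw [← hA.semigroup_max t, ← hA.semigroup_max s]
  refine (le_of_tendsto ((hA.tendsto_semigroup ht X).sub (hA.tendsto_semigroup hs X)).norm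
    (Eventually.of_forall fun n => ?_)).trans
    (mul_le_mul_of_nonneg_left (abs_max_sub_max_le_abs t s 0) (norm_nonneg Y))
  exact (norm_exp_smul_sub_le (hA.re_inner_yosida_le_zero n) hs ht X).trans
    (mul_le_mul_of_nonneg_right (hA.norm_yosida_le_of_mem_graph h n) (abs_nonneg _))

/-- Orbits from the domain are Lipschitz. Contractivity makes convergence of initial data uniform in
time, so the set of data with continuous orbits is closed. -/
theorem continuous_semigroup (x : E) : Continuous fun t => hA.semigroup t x := by
  have hcl : IsClosed {x : E | Continuous fun t => hA.semigroup t x} := by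
    have hlip (t : ℝ) : LipschitzWith 1 (hA.semigroup t) :=
      LipschitzWith.of_dist_le_mul fun a b => by
        rw [dist_eq_norm, dist_eq_norm, ← map_sub, NNReal.coe_one, one_mul]
        exact hA.norm_semigroup_apply_le t _
    refine isClosed_of_closure_subset fun x hx => ?_
    obtain ⟨u, hu, hlim⟩ := mem_closure_iff_seq_limit.1 hx
    refine TendstoUniformly.continuous (F := fun n t => hA.semigroup t (u n)) (p := atTop) ?_
      (Eventually.frequently (Eventually.of_forall hu))
    rw [Metric.tendstoUniformly_iff]
    intro ε hε
    filter_upwards [Metric.tendsto_nhds.1 hlim ε hε] with n hn t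
    have := (hlip t).dist_le_mul x (u n)
    rw [NNReal.coe_one, one_mul] at this
    exact this.trans_lt (by rwa [dist_comm])
  have hsub : (A.domain : Set E) ⊆ {x : E | Continuous fun t => hA.semigroup t x} := fun x hx =>
    LipschitzWith.continuous (K := ‖A ⟨x, hx⟩‖₊) <| LipschitzWith.of_dist_le_mul fun t s => by
      rw [dist_eq_norm, Real.dist_eq]
      exact hA.norm_semigroup_sub_le (A.mem_graph ⟨x, hx⟩) s t
  exact hcl.closure_subset_iff.2 hsub (hA.dense_domain x)

theorem isC0ContractionSemigroup : IsC0ContractionSemigroup hA.semigroup where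
  zero := ContinuousLinearMap.ext fun x => hA.semigroup_of_nonpos le_rfl x
  add _ _ hs ht := hA.semigroup_add hs ht
  contraction t _ := ContinuousLinearMap.opNorm_le_bound _ zero_le_one fun x => by
    rw [one_mul]; exact hA.norm_semigroup_apply_le t x
  strong x := (hA.continuous_semigroup x).continuousOn

/-- The integrated equation survives the limit by dominated convergence: `‖Y‖` bounds every
integrand because `‖hA.yosida n X‖ ≤ ‖Y‖`. Differentiability is then recovered from the integral. -/
theorem semigroup_eq_add_integral {X Y : E} (h : (X, Y) ∈ A.graph) {t : ℝ} (ht : 0 ≤ t) :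
    hA.semigroup t X = X + ∫ s in (0 : ℝ)..t, hA.semigroup s Y := by
  have hcont (n : ℕ) (x : E) : Continuous fun s : ℝ => NormedSpace.exp (s • hA.yosida n) x :=
    continuous_iff_continuousAt.2 fun s =>
      (hasDerivAt_exp_smul_apply (hA.yosida n) x s).continuousAt
  have hint (n : ℕ) : NormedSpace.exp (t • hA.yosida n) X =
      X + ∫ s in (0 : ℝ)..t, NormedSpace.exp (s • hA.yosida n) (hA.yosida n X) := by
    rw [intervalIntegral.integral_eq_sub_of_hasDerivAt
      (fun s _ => hasDerivAt_exp_smul_apply (hA.yosida n) X s)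
      ((hcont n _).intervalIntegrable _ _)]
    simp
  refine tendsto_nhds_unique (hA.tendsto_semigroup ht X) ?_
  simp only [hint]
  refine tendsto_const_nhds.add ?_
  refine intervalIntegral.tendsto_integral_filter_of_dominated_convergence (fun _ => ‖Y‖)
    (Eventually.of_forall fun n => (hcont n _).aestronglyMeasurable)
    (Eventually.of_forall fun n => Eventually.of_forall fun s hs => ?_)
    intervalIntegrable_const (Eventually.of_forall fun s hs => ?_)
  · rw [uIoc_of_le ht] at hs
    exact (norm_exp_smul_apply_le (hA.re_inner_yosida_le_zero n) hs.1.le _).trans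
      (hA.norm_yosida_le_of_mem_graph h n)
  · rw [uIoc_of_le ht] at hs
    have h1 := hA.tendsto_semigroup hs.1.le Y
    have h2 : Tendsto (fun n => NormedSpace.exp (s • hA.yosida n) (hA.yosida n X - Y)) atTop
        (𝓝 0) :=
      squeeze_zero_norm
        (fun n => norm_exp_smul_apply_le (hA.re_inner_yosida_le_zero n) hs.1.le _)
        (tendsto_iff_norm_sub_tendsto_zero.1 (hA.tendsto_yosida h))
    have h3 := h1.add h2
    rw [add_zero] at h3
    refine h3.congr fun n => ?_
    rw [map_sub, add_sub_cancel]

theorem hasDerivWithinAt_semigroup {X Y : E} (h : (X, Y) ∈ A.graph) {t : ℝ} (ht : 0 ≤ t) :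
    HasDerivWithinAt (fun s => hA.semigroup s X) (hA.semigroup t Y) (Ici 0) t := by
  -- The clamped orbit is continuous on all of `ℝ`, so the integral has a two-sided derivative even
  -- at `t = 0`.
  have h1 := ((hA.continuous_semigroup Y).integral_hasStrictDerivAt 0 t).hasDerivAt.const_add X
  exact h1.hasDerivWithinAt.congr_of_mem (fun s hs => hA.semigroup_eq_add_integral h hs) ht

end IsMDissipative

/-! ### Weak and strong solutions, and the generator. -/

section Solutions

variable {E : Type*} [NormedAddCommGroup E] [InnerProductSpace ℂ E] {A : E →ₗ.[ℂ] E}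

theorem IsStrongSolution.isWeakSolution {U₀ : E} {U : ℝ → E} (h : IsStrongSolution A U₀ U) :
    IsWeakSolution A U₀ U where
  init := h.init
  cont := h.contDiff.continuousOn
  eqn V W hVW t ht := by
    obtain ⟨AU, hg, -, hd⟩ := h.eqn
    obtain ⟨X, hX, hAX⟩ := (LinearPMap.mem_graph_iff A).1 (hg t ht)
    have h1 := hVW X
    dsimp only at hX hAX
    rw [hX, hAX] at h1
    rw [← h1]
    exact ((innerSL ℂ V).restrictScalars ℝ).hasFDerivAt.comp_hasDerivWithinAt t (hd t ht)

theorem IsWeakSolution.sub {U₀ U₁ : E} {U V : ℝ → E} (h : IsWeakSolution A U₀ U)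
    (h' : IsWeakSolution A U₁ V) : IsWeakSolution A (U₀ - U₁) (fun t => U t - V t) where
  init := by rw [h.init, h'.init]
  cont := h.cont.sub h'.cont
  eqn X W hXW t ht := by
    simp only [inner_sub_right]
    exact (h.eqn X W hXW t ht).sub (h'.eqn X W hXW t ht)

namespace IsMDissipative

variable [CompleteSpace E] (hA : IsMDissipative A)

/-- This is `A** ⊆ A`. Vectors `R* F`, with `R` the resolvent at `1`, are enough test vectors to
force `z = R (z - w)`. -/
theorem mem_graph_of_forall_adjoint (hA : IsMDissipative A) {z w : E}
    (h : ∀ V W : E, (∀ X : A.domain, ⟪V, A X⟫_ℂ = ⟪W, (X : E)⟫_ℂ) → ⟪V, w⟫_ℂ = ⟪W, z⟫_ℂ) :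
    (z, w) ∈ A.graph := by
  set R := hA.resolvent 1 one_pos
  have hR : z = R (z - w) := by
    refine ext_inner_left ℂ fun F => ?_
    -- `V = R* F` belongs to `D(A*)`, with `A* V = R* F - F`.
    have h1 := h (R.adjoint F) (R.adjoint F - F) fun X => ?_
    · rw [inner_sub_left, ContinuousLinearMap.adjoint_inner_left,
        ContinuousLinearMap.adjoint_inner_left] at h1
      rw [map_sub, inner_sub_right, h1, sub_sub_cancel]
    · have h2 := hA.resolvent_apply one_pos (A.mem_graph X)
      rw [Complex.ofReal_one, one_smul] at h2
      rw [map_sub] at h2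
      have h3 : R (A X) = R X - X := (sub_eq_of_eq_add' (sub_eq_iff_eq_add.1 h2)).symm
      rw [inner_sub_left, ContinuousLinearMap.adjoint_inner_left,
        ContinuousLinearMap.adjoint_inner_left, h3, inner_sub_right]
  have hg := hA.resolvent_graph one_pos (z - w)
  change (R (z - w), _ • R (z - w) - _) ∈ _ at hg
  rwa [← hR, Complex.ofReal_one, one_smul, sub_sub_cancel] at hg

/-- Integration in time gains regularity: `z = ∫ w` lies in `D(A)` with `z' = w = A z` and `z 0 =
0`. Dissipativity gives `z = 0`, and then `w = A z = 0`. -/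
theorem eq_zero_of_isWeakSolution (hA : IsMDissipative A) {w : ℝ → E} (hw : IsWeakSolution A 0 w) {t : ℝ} (ht : 0 ≤ t) :
    w t = 0 := by
  have hc : Continuous fun s => w (max s 0) :=
    hw.cont.comp_continuous (by fun_prop) fun s => le_max_right s 0
  set z : ℝ → E := fun t => ∫ s in (0 : ℝ)..t, w (max s 0)
  have hzd (t : ℝ) : HasDerivAt z (w (max t 0)) t := (hc.integral_hasStrictDerivAt 0 t).hasDerivAt
  have hzg (t : ℝ) (ht : 0 ≤ t) : (z t, w (max t 0)) ∈ A.graph := by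
    rw [max_eq_left ht]
    refine hA.mem_graph_of_forall_adjoint fun V W hVW => ?_
    have hd := hw.eqn V W hVW
    have hin (t : ℝ) : HasDerivAt (fun t => ⟪W, z t⟫_ℂ) ⟪W, w (max t 0)⟫_ℂ t :=
      ((innerSL ℂ W).restrictScalars ℝ).hasFDerivAt.comp_hasDerivAt t (hzd t)
    have hdiff (s : ℝ) (hs : 0 ≤ s) :
        HasDerivWithinAt (fun s => ⟪V, w s⟫_ℂ - ⟪W, z s⟫_ℂ) 0 (Ici 0) s := by
      have h1 := (hd s hs).sub (hin s).hasDerivWithinAt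
      rwa [max_eq_left hs, sub_self] at h1
    -- Used in the space `ℂ` with zero derivative: a scalar function that starts at `0` stays there.
    have h1 := norm_le_of_re_inner_deriv_nonpos hdiff (fun s _ => by simp) ht
    have h2 : z 0 = 0 := intervalIntegral.integral_same
    rw [hw.init, h2, inner_zero_right, inner_zero_right, sub_zero, norm_zero] at h1
    exact sub_eq_zero.1 (norm_le_zero_iff.1 h1)
  have hz0 (t : ℝ) (ht : 0 ≤ t) : z t = 0 := by
    have h1 := norm_le_of_re_inner_deriv_nonpos (fun s _ => (hzd s).hasDerivWithinAt)
      (fun s hs => hA.1.re_inner_le_zero (hzg s hs)) ht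
    have h2 : z 0 = 0 := intervalIntegral.integral_same
    rw [h2, norm_zero] at h1
    exact norm_le_zero_iff.1 h1
  have hg := hzg t ht
  rw [hz0 t ht, max_eq_left ht] at hg
  exact A.graph_fst_eq_zero_snd hg rfl

theorem eqOn_of_isWeakSolution (hA : IsMDissipative A) {U₀ : E} {U V : ℝ → E} (hU : IsWeakSolution A U₀ U)
    (hV : IsWeakSolution A U₀ V) : EqOn U V (Ici 0) := fun t ht => by
  have h := hU.sub hV
  rw [sub_self] at h
  exact sub_eq_zero.1 (hA.eq_zero_of_isWeakSolution h ht)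

theorem tendsto_slope_semigroup {X Y : E} (h : (X, Y) ∈ A.graph) :
    Tendsto (fun t : ℝ => t⁻¹ • (hA.semigroup t X - X)) (𝓝[>] 0) (𝓝 Y) := by
  have h1 := (hA.hasDerivWithinAt_semigroup h le_rfl).mono Ioi_subset_Ici_self
  rw [hasDerivWithinAt_iff_tendsto_slope' self_notMem_Ioi, hA.semigroup_of_nonpos le_rfl] at h1
  refine h1.congr fun t => ?_
  rw [slope_def_module, hA.semigroup_of_nonpos le_rfl, sub_zero]

/-- For the converse, choose `X ∈ D(A)` with `X - A X = U - W`. The difference quotients at `U - X`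
tend to `U - X` itself, while contractivity makes their pairing with `U - X` nonpositive in real
part; hence `U = X`. -/
theorem isGenerator_semigroup : IsGenerator hA.semigroup A := fun U W => by
  refine ⟨hA.tendsto_slope_semigroup, fun h => ?_⟩
  have hg := hA.resolvent_graph one_pos (U - W)
  set X := hA.resolvent 1 one_pos (U - W)
  rw [Complex.ofReal_one, one_smul] at hg
  have h1 : Tendsto (fun t : ℝ => t⁻¹ • (hA.semigroup t (U - X) - (U - X))) (𝓝[>] 0)
      (𝓝 (U - X)) := by
    have h2 := h.sub (hA.tendsto_slope_semigroup hg)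
    have e : W - (X - (U - W)) = U - X := by abel
    rw [e] at h2
    refine h2.congr fun t => ?_
    rw [← smul_sub, map_sub]
    congr 1
    abel
  have h2 : (⟪U - X, U - X⟫_ℂ).re ≤ 0 := by
    refine le_of_tendsto (Complex.continuous_re.continuousAt.tendsto.comp
      (h1.inner tendsto_const_nhds)) ?_
    filter_upwards [self_mem_nhdsWithin] with t ht
    have h3 : (⟪hA.semigroup t (U - X), U - X⟫_ℂ).re ≤ ‖hA.semigroup t (U - X)‖ * ‖U - X‖ :=
      re_inner_le_norm (𝕜 := ℂ) _ _
    have h4 : (⟪U - X, U - X⟫_ℂ).re = ‖U - X‖ ^ 2 := inner_self_eq_norm_sq (𝕜 := ℂ) _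
    have h5 := mul_le_mul_of_nonneg_right (hA.norm_semigroup_apply_le t (U - X))
      (norm_nonneg (U - X))
    have h6 : t⁻¹ • (hA.semigroup t (U - X) - (U - X)) =
        ((t⁻¹ : ℝ) : ℂ) • (hA.semigroup t (U - X) - (U - X)) := (Complex.coe_smul _ _).symm
    change (⟪t⁻¹ • (hA.semigroup t (U - X) - (U - X)), U - X⟫_ℂ).re ≤ 0
    rw [h6, inner_smul_left, Complex.conj_ofReal, Complex.re_ofReal_mul, inner_sub_left,
      Complex.sub_re, h4]
    refine mul_nonpos_of_nonneg_of_nonpos (inv_nonneg.2 (le_of_lt ht)) ?_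
    linarith
  have h4 : (⟪U - X, U - X⟫_ℂ).re = ‖U - X‖ ^ 2 := inner_self_eq_norm_sq (𝕜 := ℂ) _
  have h5 : U = X := by
    rw [h4] at h2
    exact sub_eq_zero.1 (by simpa using le_antisymm h2 (sq_nonneg _))
  rwa [← h5, sub_sub_cancel] at hg

/-- The semigroup commutes with its own difference quotients, so the description of `A` as generator
applies. -/
theorem semigroup_mem_graph {X Y : E} (h : (X, Y) ∈ A.graph) {t : ℝ} (ht : 0 ≤ t) :
    (hA.semigroup t X, hA.semigroup t Y) ∈ A.graph := by
  refine (hA.isGenerator_semigroup _ _).2 ?_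
  have h1 := ((hA.semigroup t).continuous.tendsto Y).comp (hA.tendsto_slope_semigroup h)
  refine h1.congr' ?_
  filter_upwards [self_mem_nhdsWithin] with s hs
  have h2 : hA.semigroup s (hA.semigroup t X) = hA.semigroup t (hA.semigroup s X) := by
    rw [← ContinuousLinearMap.comp_apply, ← ContinuousLinearMap.comp_apply,
      ← hA.semigroup_add (le_of_lt hs) ht, ← hA.semigroup_add ht (le_of_lt hs), add_comm]
  rw [Function.comp_apply, (hA.semigroup t).map_smul_of_tower, map_sub, h2]

theorem isStrongSolution_semigroup {U₀ : E} (hU : U₀ ∈ A.domain) :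
    IsStrongSolution A U₀ fun t => hA.semigroup t U₀ := by
  have hg := A.mem_graph ⟨U₀, hU⟩
  have hd (t : ℝ) (ht : 0 ≤ t) := hA.hasDerivWithinAt_semigroup hg ht
  have hc := (hA.continuous_semigroup (A ⟨U₀, hU⟩)).continuousOn (s := Ici 0)
  refine ⟨hA.semigroup_of_nonpos le_rfl U₀, ?_, fun t => hA.semigroup t (A ⟨U₀, hU⟩),
    fun t ht => hA.semigroup_mem_graph hg ht, hc, hd⟩
  refine (contDiffOn_one_iff_derivWithin (uniqueDiffOn_Ici 0)).2
    ⟨fun t ht => (hd t ht).differentiableWithinAt, hc.congr fun t ht => ?_⟩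
  exact (hd t ht).derivWithin (uniqueDiffOn_Ici 0 t ht)

/-- For `x ∈ D(A)` this integrates the weak equation of a strong solution. Both sides are continuous
in `x`, so density removes the restriction. -/
theorem inner_semigroup_eq_add_integral {V W : E}
    (hVW : ∀ X : A.domain, ⟪V, A X⟫_ℂ = ⟪W, (X : E)⟫_ℂ) (x : E) {t : ℝ} (ht : 0 ≤ t) :
    ⟪V, hA.semigroup t x⟫_ℂ = ⟪V, x⟫_ℂ + ∫ s in (0 : ℝ)..t, ⟪W, hA.semigroup s x⟫_ℂ := by
  have hcl : IsClosed {x : E | ⟪V, hA.semigroup t x⟫_ℂ =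
      ⟪V, x⟫_ℂ + ∫ s in (0 : ℝ)..t, ⟪W, hA.semigroup s x⟫_ℂ} := by
    refine isClosed_eq (by fun_prop) (Continuous.add (by fun_prop) ?_)
    have hint (x : E) : IntervalIntegrable (fun s => ⟪W, hA.semigroup s x⟫_ℂ) volume 0 t :=
      (continuous_const.inner (hA.continuous_semigroup x)).intervalIntegrable _ _
    refine LipschitzWith.continuous (K := ‖W‖₊ * ‖t‖₊) (LipschitzWith.of_dist_le_mul fun x y => ?_)
    rw [dist_eq_norm, dist_eq_norm, ← intervalIntegral.integral_sub (hint x) (hint y)]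
    have h := intervalIntegral.norm_integral_le_of_norm_le_const (a := (0 : ℝ)) (b := t)
      (C := ‖W‖ * ‖x - y‖) (f := fun s => ⟪W, hA.semigroup s x⟫_ℂ - ⟪W, hA.semigroup s y⟫_ℂ)
      fun s _ => by
        rw [← inner_sub_right, ← map_sub]
        exact (norm_inner_le_norm _ _).trans
          (mul_le_mul_of_nonneg_left (hA.norm_semigroup_apply_le s _) (norm_nonneg _))
    refine h.trans_eq ?_
    rw [sub_zero, NNReal.coe_mul, coe_nnnorm, coe_nnnorm, Real.norm_eq_abs]
    ring
  refine hcl.closure_subset_iff.2 (fun x hx => ?_) (hA.dense_domain x)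
  have hS := (hA.isStrongSolution_semigroup hx).isWeakSolution.eqn V W hVW
  have hc : Continuous fun s => ⟪W, hA.semigroup s x⟫_ℂ :=
    continuous_const.inner (hA.continuous_semigroup x)
  have h1 := intervalIntegral.integral_eq_sub_of_hasDeriv_right_of_le ht
    (fun s hs => (hS s hs.1).continuousWithinAt.mono Icc_subset_Ici_self)
    (fun s hs => (hS s hs.1.le).mono (Ioi_subset_Ici hs.1.le)) (hc.intervalIntegrable 0 t)
  change _ = _
  rw [h1, hA.semigroup_of_nonpos le_rfl, add_sub_cancel]

theorem isWeakSolution_semigroup (U₀ : E) :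
    IsWeakSolution A U₀ fun t => hA.semigroup t U₀ where
  init := hA.semigroup_of_nonpos le_rfl U₀
  cont := (hA.continuous_semigroup U₀).continuousOn
  eqn V W hVW t ht := by
    have hc : Continuous fun s => ⟪W, hA.semigroup s U₀⟫_ℂ :=
      continuous_const.inner (hA.continuous_semigroup U₀)
    exact ((hc.integral_hasStrictDerivAt 0 t).hasDerivAt.const_add ⟪V, U₀⟫_ℂ).hasDerivWithinAt
      |>.congr_of_mem (fun s hs => hA.inner_semigroup_eq_add_integral hVW U₀ hs) ht

end IsMDissipative

end Solutions

/-! ### Lax–Milgram, weak derivatives by duality, and step multipliers. -/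

theorem ContinuousLinearMap.exists_mem_forall_inner_eq_of_coercive {N : Type*}
    [NormedAddCommGroup N] [InnerProductSpace ℂ N] (K : Submodule ℂ N) [CompleteSpace K]
    (T : N →L[ℂ] N) {c : NNReal} (hc : 0 < c) (hT : ∀ x, ‖x‖ ^ 2 * c ≤ (⟪T x, x⟫_ℂ).re) (g : N) :
    ∃ x ∈ K, ∀ k ∈ K, ⟪k, T x⟫_ℂ = ⟪k, g⟫_ℂ := by
  -- The compression of `T` to `K` inherits coercivity, hence is invertible on `K`.
  set S : K →L[ℂ] K := K.orthogonalProjectionOnto.comp (T.comp K.subtypeL)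
  have hproj (k : K) (x : N) : ⟪(k : N), x⟫_ℂ = ⟪k, K.orthogonalProjectionOnto x⟫_ℂ := by simp
  have hu : IsUnit S := by
    refine S.isUnit_of_forall_le_norm_inner_map hc fun x => ?_
    have h : ⟪S x, x⟫_ℂ = ⟪T x, (x : N)⟫_ℂ := by
      rw [← inner_conj_symm, ← inner_conj_symm (T x), hproj]
      rfl
    rw [h]
    exact (hT x).trans (Complex.re_le_norm _)
  obtain ⟨x, hx⟩ := (ContinuousLinearMap.isUnit_iff_bijective.1 hu).2 (K.orthogonalProjectionOnto g)
  refine ⟨x, x.2, fun k hk => ?_⟩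
  rw [hproj ⟨k, hk⟩ (T x), hproj ⟨k, hk⟩ g, ← hx]
  rfl

theorem IsTestFun.star {L : ℝ} {φ : ℝ → ℂ} (hφ : IsTestFun L φ) :
    IsTestFun L (fun x => (starRingEnd ℂ) (φ x)) where
  smooth := Complex.conjCLE.contDiff.comp hφ.smooth
  compact := hφ.compact.comp_left (g := starRingEnd ℂ) (map_zero _)
  supp := by
    refine (closure_mono fun x hx => ?_).trans hφ.supp
    intro h
    exact hx (by simp [h])

theorem IsTestFun.deriv_star {L : ℝ} {φ : ℝ → ℂ} (hφ : IsTestFun L φ) :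
    deriv (fun x => (starRingEnd ℂ) (φ x)) = fun x => (starRingEnd ℂ) (deriv φ x) := by
  ext x
  exact (Complex.conjCLE.toContinuousLinearMap.hasFDerivAt.comp_hasDerivAt x
    (hφ.differentiable x).hasDerivAt).deriv

theorem inner_eq_integral_of_ae_eq {L : ℝ} {p f : L2 L} {φ : ℝ → ℂ} (h : p =ᵐ[muI L] φ) :
    ⟪p, f⟫_ℂ = ∫ x in Ioo 0 L, f x * (starRingEnd ℂ) (φ x) := by
  rw [L2.inner_def]
  refine integral_congr_ae ?_
  filter_upwards [h] with x hx
  rw [hx]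
  rfl

/-- The defining integrals carry no conjugate while the inner product does; conjugation preserves
the test functions, so the two conditions agree. -/
theorem hasWeakDeriv_iff_inner {L : ℝ} {f g : L2 L} :
    HasWeakDeriv L f g ↔ ∀ p ∈ testGraph L, ⟪p.2, f⟫_ℂ = -⟪p.1, g⟫_ℂ := by
  constructor
  · rintro h p ⟨φ, hφ, h1, h2⟩
    have := h _ hφ.star
    rwa [hφ.deriv_star, ← inner_eq_integral_of_ae_eq h1, ← inner_eq_integral_of_ae_eq h2] at this
  · intro h φ hφ
    have h1 := (hφ.star.memLp 2).coeFn_toLp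
    have h2 := (hφ.star.deriv_test.memLp 2).coeFn_toLp
    have h3 := h ((hφ.star.memLp 2).toLp _, (hφ.star.deriv_test.memLp 2).toLp _)
      ⟨_, hφ.star, h1, h2⟩
    dsimp only at h3
    rw [inner_eq_integral_of_ae_eq h1, inner_eq_integral_of_ae_eq h2, hφ.deriv_star] at h3
    simpa using h3

/-- Integration by parts for `u ∈ H¹₀` and `f ∈ H¹`. -/
theorem inner_weakDeriv_eq_neg_inner {L : ℝ} {f g u : L2 L} (h : HasWeakDeriv L f g)
    (hu : u ∈ H10 L) : ⟪weakDeriv L u, f⟫_ℂ = -⟪u, g⟫_ℂ := by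
  have hcl : IsClosed {p : L2 L × L2 L | ⟪p.2, f⟫_ℂ = -⟪p.1, g⟫_ℂ} :=
    isClosed_eq (by fun_prop) (by fun_prop)
  exact closure_minimal (hasWeakDeriv_iff_inner.1 h) hcl (mem_closure_of_mem_H10 hu)

theorem inner_stepMul_left {L : ℝ} (k s t : ℝ) (f g : L2 L) :
    ⟪stepMul L k s t f, g⟫_ℂ =
      ∫ x in Ioo 0 L, (stepFun k s t x : ℂ) * (g x * (starRingEnd ℂ) (f x)) := by
  rw [L2.inner_def]
  refine integral_congr_ae ?_
  filter_upwards [(stepFun_mul_memLp k s t f).coeFn_toLp] with x hx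
  change g x * (starRingEnd ℂ) ((stepFun_mul_memLp k s t f).toLp _ x) = _
  rw [hx, map_mul, Complex.conj_ofReal]
  ring

theorem isSymmetric_stepMul (L k s t : ℝ) : (stepMul L k s t).IsSymmetric := fun f g => by
  rw [inner_stepMul_left, L2.inner_def]
  refine integral_congr_ae ?_
  filter_upwards [(stepFun_mul_memLp k s t g).coeFn_toLp] with x hx
  change _ = (stepFun_mul_memLp k s t g).toLp _ x * (starRingEnd ℂ) (f x)
  rw [hx]
  ring

theorem re_inner_stepMul_nonneg {L k : ℝ} (hk : 0 ≤ k) (s t : ℝ) (f : L2 L) :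
    0 ≤ (⟪stepMul L k s t f, f⟫_ℂ).re := by
  have h : ⟪stepMul L k s t f, f⟫_ℂ =
      ((∫ x in Ioo 0 L, stepFun k s t x * Complex.normSq (f x) : ℝ) : ℂ) := by
    rw [inner_stepMul_left, ← integral_complex_ofReal]
    simp only [Complex.mul_conj, Complex.ofReal_mul]
  rw [h, Complex.ofReal_re]
  exact integral_nonneg fun x =>
    mul_nonneg (indicator_nonneg (fun _ _ => hk) _) (Complex.normSq_nonneg _)

/-- Multiplication by `stepFun k s t` as a bounded operator on `L²(0, L)`. -/
def stepMulL (L k s t : ℝ) : L2 L →L[ℂ] L2 L :=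
  -- Hellinger–Toeplitz: an everywhere defined symmetric operator is bounded.
  ⟨stepMul L k s t, (isSymmetric_stepMul L k s t).continuous⟩

/-! ### The wave operator is m-dissipative. -/

namespace WaveData

variable (P : WaveData)

open EnergySpace

/-- In the real part, `a ⟪v_x, u_x⟫` cancels against the elastic part of the stress, `⟪y_xx, z⟫`
against `⟪z_x, y_x⟫`, and the two `c` terms against each other. What is left is the damping. -/
theorem isDissipative_opA : IsDissipative P.opA := by
  rintro ⟨U, hy, hv, hz, hs⟩
  change (⟪weakDeriv P.L (P.stress U) - P.mulC U.z, U.v⟫_ℂ +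
    (P.a : ℂ) * ⟪weakDeriv P.L U.v, U.ux⟫_ℂ +
    ⟪weakDeriv P.L U.yx + P.mulC U.v, U.z⟫_ℂ + ⟪weakDeriv P.L U.z, U.yx⟫_ℂ).re ≤ 0
  have h1 := inner_weakDeriv_eq_neg_inner (hasWeakDeriv_weakDeriv hs) hv
  have h2 := inner_weakDeriv_eq_neg_inner (hasWeakDeriv_weakDeriv (f := U.yx) hy.2) hz
  have h3 : ⟪P.mulC U.z, U.v⟫_ℂ = ⟪U.z, P.mulC U.v⟫_ℂ := isSymmetric_stepMul _ _ _ _ _ _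
  have h4 : 0 ≤ (⟪P.mulB (weakDeriv P.L U.v), weakDeriv P.L U.v⟫_ℂ).re :=
    re_inner_stepMul_nonneg P.b₀_pos.le _ _ _
  have symm (f g : L2 P.L) : (⟪f, g⟫_ℂ).re = (⟪g, f⟫_ℂ).re := inner_re_symm (𝕜 := ℂ) f g
  rw [stress, inner_add_right, inner_smul_right] at h1
  have h1' := congrArg Complex.re h1
  have h2' := congrArg Complex.re h2
  rw [inner_sub_left, inner_add_left, h3, h2]
  simp only [Complex.add_re, Complex.sub_re, Complex.neg_re, Complex.re_ofReal_mul] at h1' h2' ⊢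
  rw [symm (weakDeriv P.L (P.stress U)), symm (P.mulC U.v), symm (weakDeriv P.L U.yx)]
  rw [symm (P.mulB _)] at h4
  change _ = -(⟪U.v, weakDeriv P.L (P.stress U)⟫_ℂ).re at h1'
  linarith

/-- The bounded coercive operator on `L²(0, L)⁴`, whose elements are written `(v, v_x, z, z_x)`, of
the variational form of the resolvent equation. -/
def resolventForm (r : ℝ) : PiLp 2 (fun _ : Fin 4 => L2 P.L) →L[ℂ] PiLp 2 fun _ : Fin 4 => L2 P.L :=
  let π (i : Fin 4) : PiLp 2 (fun _ : Fin 4 => L2 P.L) →L[ℂ] L2 P.L := PiLp.proj 2 _ i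
  let B := stepMulL P.L P.b₀ P.α₁ P.α₃
  let C := stepMulL P.L P.c₀ P.α₂ P.α₄
  (PiLp.continuousLinearEquiv 2 ℂ _).symm.toContinuousLinearMap.comp <| ContinuousLinearMap.pi
    ![(r : ℂ) • π 0 + C.comp (π 2), ((P.a * r⁻¹ : ℝ) : ℂ) • π 1 + B.comp (π 1),
      (r : ℂ) • π 2 - C.comp (π 0), ((r⁻¹ : ℝ) : ℂ) • π 3]

theorem inner_resolventForm_left (r : ℝ) (x y : PiLp 2 fun _ : Fin 4 => L2 P.L) :
    ⟪x, P.resolventForm r y⟫_ℂ = ⟪x 0, (r : ℂ) • y 0 + P.mulC (y 2)⟫_ℂ +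
      ⟪x 1, ((P.a * r⁻¹ : ℝ) : ℂ) • y 1 + P.mulB (y 1)⟫_ℂ +
      ⟪x 2, (r : ℂ) • y 2 - P.mulC (y 0)⟫_ℂ + ⟪x 3, ((r⁻¹ : ℝ) : ℂ) • y 3⟫_ℂ := by
  rw [PiLp.inner_apply, Fin.sum_univ_four]
  rfl

/-- The coupling is skew in `(v, z)` and drops out of the real part, and the damping is nonnegative.
The constant is the least of the diagonal coefficients `r`, `a / r`, `r`, `1 / r`. -/
theorem exists_coercive_resolventForm {r : ℝ} (hr : 0 < r) : ∃ c : NNReal, 0 < c ∧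
    ∀ x, ‖x‖ ^ 2 * c ≤ (⟪P.resolventForm r x, x⟫_ℂ).re := by
  have ha := P.a_pos
  set m := min r (min (P.a * r⁻¹) r⁻¹)
  have hm0 : 0 < m := by positivity
  have m1 : m ≤ r := min_le_left _ _
  have m2 : m ≤ P.a * r⁻¹ := (min_le_right _ _).trans (min_le_left _ _)
  have m3 : m ≤ r⁻¹ := (min_le_right _ _).trans (min_le_right _ _)
  refine ⟨⟨m, hm0.le⟩, hm0, fun x => ?_⟩
  have symm {F : Type _} [NormedAddCommGroup F] [InnerProductSpace ℂ F] (f g : F) :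
    (⟪f, g⟫_ℂ).re = (⟪g, f⟫_ℂ).re := inner_re_symm (𝕜 := ℂ) f g
  have self (f : L2 P.L) : (⟪f, f⟫_ℂ).re = ‖f‖ ^ 2 := inner_self_eq_norm_sq (𝕜 := ℂ) f
  have h3 : ⟪P.mulC (x 0), x 2⟫_ℂ = ⟪x 0, P.mulC (x 2)⟫_ℂ := isSymmetric_stepMul _ _ _ _ _ _
  have h4 : 0 ≤ (⟪P.mulB (x 1), x 1⟫_ℂ).re := re_inner_stepMul_nonneg P.b₀_pos.le _ _ _
  rw [symm, inner_resolventForm_left, PiLp.norm_sq_eq_of_L2, Fin.sum_univ_four]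
  simp only [inner_add_right, inner_sub_right, inner_smul_right, Complex.add_re, Complex.sub_re,
    Complex.re_ofReal_mul, self]
  rw [symm (x 2), h3, symm (x 1) (P.mulB _)]
  have k0 := mul_le_mul_of_nonneg_right m1 (sq_nonneg ‖x 0‖)
  have k1 := mul_le_mul_of_nonneg_right m2 (sq_nonneg ‖x 1‖)
  have k2 := mul_le_mul_of_nonneg_right m1 (sq_nonneg ‖x 2‖)
  have k3 := mul_le_mul_of_nonneg_right m3 (sq_nonneg ‖x 3‖)
  change _ * m ≤ _
  linarith

/-- The closed subspace of `L²(0, L)⁴` of the `(v, v_x, z, z_x)` with `v, z ∈ H¹₀(0, L)`. -/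
def H10Graph (L : ℝ) : Submodule ℂ (PiLp 2 fun _ : Fin 4 => L2 L) :=
  let π (i : Fin 4) : PiLp 2 (fun _ : Fin 4 => L2 L) →L[ℂ] L2 L := PiLp.proj 2 _ i
  (testGraph L).topologicalClosure.comap ((π 0).prod (π 1)).toLinearMap ⊓
    (testGraph L).topologicalClosure.comap ((π 2).prod (π 3)).toLinearMap

theorem isClosed_H10Graph (L : ℝ) : IsClosed (H10Graph L : Set (PiLp 2 fun _ : Fin 4 => L2 L)) :=
  ((testGraph L).isClosed_topologicalClosure.preimage (ContinuousLinearMap.continuous _)).inter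
    ((testGraph L).isClosed_topologicalClosure.preimage (ContinuousLinearMap.continuous _))

/-- The solution of the variational form of the resolvent equation. -/
theorem exists_variational_solution {r : ℝ} (hr : 0 < r) (g₀ g₁ g₂ g₃ : L2 P.L) :
    ∃ v ∈ H10 P.L, ∃ z ∈ H10 P.L, ∀ p ∈ testGraph P.L,
      ⟪p.1, (r : ℂ) • v + P.mulC z⟫_ℂ +
          ⟪p.2, ((P.a * r⁻¹ : ℝ) : ℂ) • weakDeriv P.L v + P.mulB (weakDeriv P.L v)⟫_ℂ =
        ⟪p.1, g₀⟫_ℂ + ⟪p.2, g₁⟫_ℂ ∧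
      ⟪p.1, (r : ℂ) • z - P.mulC v⟫_ℂ + ⟪p.2, ((r⁻¹ : ℝ) : ℂ) • weakDeriv P.L z⟫_ℂ =
        ⟪p.1, g₂⟫_ℂ + ⟪p.2, g₃⟫_ℂ := by
  obtain ⟨c, hc, hT⟩ := P.exists_coercive_resolventForm hr
  have := (isClosed_H10Graph P.L).completeSpace_coe
  obtain ⟨x, ⟨h01, h23⟩, hx⟩ := (P.resolventForm r).exists_mem_forall_inner_eq_of_coercive
    (H10Graph P.L) hc hT (WithLp.toLp 2 ![g₀, g₁, g₂, g₃])
  have e1 : weakDeriv P.L (x 0) = x 1 := (hasWeakDeriv_of_mem_closure h01).weakDeriv_eq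
  have e3 : weakDeriv P.L (x 2) = x 3 := (hasWeakDeriv_of_mem_closure h23).weakDeriv_eq
  refine ⟨x 0, ⟨_, h01, rfl⟩, x 2, ⟨_, h23, rfl⟩, fun p hp => ?_⟩
  have hp' := (testGraph P.L).le_topologicalClosure hp
  -- Test vectors supported in one pair of components separate the `v` equation from the `z`
  -- equation.
  have k1 := hx (WithLp.toLp 2 ![p.1, p.2, 0, 0]) ⟨hp', zero_mem (testGraph P.L).topologicalClosure⟩
  have k2 := hx (WithLp.toLp 2 ![0, 0, p.1, p.2]) ⟨zero_mem (testGraph P.L).topologicalClosure, hp'⟩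
  rw [inner_resolventForm_left, PiLp.inner_apply, Fin.sum_univ_four] at k1 k2
  rw [e1, e3]
  simp at k1 k2 ⊢
  exact ⟨k1, k2⟩

/-- Put `u = (v + F.u) / r` and `y = (z + F.y) / r`. The derivatives of `F.u` and `F.y` stay paired
with `p.2`, so no second derivative of the data is needed. The variational equations then say
exactly that the whole stress and `y_x` have weak derivatives in `L²`; `u_x` and `v_x` need not have
them separately. -/
theorem surjective_smul_sub_opA {r : ℝ} (hr : 0 < r) (F : P.EnergySpace) :
    ∃ U : P.opA.domain, (r : ℂ) • (U : P.EnergySpace) - P.opA U = F := by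
  have hr0 : (r : ℂ) ≠ 0 := by exact_mod_cast hr.ne'
  obtain ⟨v, hv, z, hz, h⟩ := P.exists_variational_solution hr F.v
    (-(((P.a * r⁻¹ : ℝ) : ℂ) • F.ux)) F.z (-(((r⁻¹ : ℝ) : ℂ) • F.yx))
  have hu := Submodule.smul_mem _ ((r⁻¹ : ℝ) : ℂ) (add_mem hv F.u_mem)
  have hy := Submodule.smul_mem _ ((r⁻¹ : ℝ) : ℂ) (add_mem hz F.y_mem)
  let U : P.EnergySpace := EnergySpace.mk ⟨_, hu⟩ v ⟨_, hy⟩ z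
  have hux : U.ux = ((r⁻¹ : ℝ) : ℂ) • (weakDeriv P.L v + F.ux) := by
    change weakDeriv P.L (_ • (v + F.u)) = _
    rw [weakDeriv_smul _ (H10_le_H1 _ (add_mem hv F.u_mem)),
      weakDeriv_add (H10_le_H1 _ hv) (H10_le_H1 _ F.u_mem)]
    rfl
  have hyx : U.yx = ((r⁻¹ : ℝ) : ℂ) • (weakDeriv P.L z + F.yx) := by
    change weakDeriv P.L (_ • (z + F.y)) = _
    rw [weakDeriv_smul _ (H10_le_H1 _ (add_mem hz F.y_mem)),
      weakDeriv_add (H10_le_H1 _ hz) (H10_le_H1 _ F.y_mem)]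
    rfl
  have hs : HasWeakDeriv P.L (P.stress U) ((r : ℂ) • v + P.mulC z - F.v) := by
    refine hasWeakDeriv_iff_inner.2 fun p hp => ?_
    have h1 := (h p hp).1
    have e : P.stress U = ((P.a * r⁻¹ : ℝ) : ℂ) • weakDeriv P.L v + P.mulB (weakDeriv P.L v) +
        ((P.a * r⁻¹ : ℝ) : ℂ) • F.ux := by
      rw [stress, hux]
      change _ + P.mulB (weakDeriv P.L v) = _
      rw [Complex.ofReal_mul]
      module
    rw [inner_neg_right] at h1
    rw [e, inner_add_right, inner_sub_right]
    linear_combination h1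
  have hyxx : HasWeakDeriv P.L U.yx ((r : ℂ) • z - P.mulC v - F.z) := by
    refine hasWeakDeriv_iff_inner.2 fun p hp => ?_
    have h1 := (h p hp).2
    rw [inner_neg_right] at h1
    rw [hyx, smul_add, inner_add_right, inner_sub_right]
    linear_combination h1
  have hU : U ∈ P.domainA :=
    ⟨⟨H10_le_H1 _ U.y_mem, ⟨_, hyxx⟩⟩, hv, hz, ⟨_, hs⟩⟩
  have hsub (f g : L2 P.L) : (r : ℂ) • (((r⁻¹ : ℝ) : ℂ) • (f + g)) - f = g := by
    rw [smul_smul, Complex.ofReal_inv, mul_inv_cancel₀ hr0, one_smul, add_sub_cancel_left]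
  refine ⟨⟨U, hU⟩, EnergySpace.ext' (hsub v F.u) ?_ (hsub z F.y) ?_⟩
  · change (r : ℂ) • v - (weakDeriv P.L (P.stress U) - P.mulC z) = F.v
    rw [hs.weakDeriv_eq]
    abel
  · change (r : ℂ) • z - (weakDeriv P.L U.yx + P.mulC v) = F.z
    rw [hyxx.weakDeriv_eq]
    abel

theorem isMDissipative_opA : IsMDissipative P.opA :=
  ⟨P.isDissipative_opA, fun _ hr F => P.surjective_smul_sub_opA hr F⟩

end WaveData

end

theorem mainTheorem7 (P : WaveData) :
    IsMDissipative P.opA ∧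
    ∃ S : ℝ → P.EnergySpace →L[ℂ] P.EnergySpace,
      IsC0ContractionSemigroup S ∧ IsGenerator S P.opA ∧
      (∀ U₀ : P.EnergySpace,
        IsWeakSolution P.opA U₀ (fun t => S t U₀) ∧
        ∀ U : ℝ → P.EnergySpace, IsWeakSolution P.opA U₀ U → EqOn U (fun t => S t U₀) (Ici 0)) ∧
      (∀ U₀ ∈ P.opA.domain,
        IsStrongSolution P.opA U₀ (fun t => S t U₀) ∧
        ∀ U : ℝ → P.EnergySpace, IsStrongSolution P.opA U₀ U →
          EqOn U (fun t => S t U₀) (Ici 0)) := by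
  have hA := P.isMDissipative_opA
  exact ⟨hA, hA.semigroup, hA.isC0ContractionSemigroup, hA.isGenerator_semigroup,
    fun U₀ => ⟨hA.isWeakSolution_semigroup U₀,
      fun U hU => hA.eqOn_of_isWeakSolution hU (hA.isWeakSolution_semigroup U₀)⟩,
    -- Strong solutions are weak solutions, so weak uniqueness covers them.
    fun U₀ hU₀ => ⟨hA.isStrongSolution_semigroup hU₀,
      fun U hU => hA.eqOn_of_isWeakSolution hU.isWeakSolution (hA.isWeakSolution_semigroup U₀)⟩⟩
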